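/- Let $k \ge 2$ and $n\ge 1$ be integers. A \emph{perfect hypermatching} of the complete $k$-uniform hypergraph $K^k_{kn}$ on the vertex set $[kn]=\{1,\dots,kn\}$ is a set of pairwise disjoint $k$-element subsets ($k$-edges) of $[kn]$ whose union is $[kn]$; let $\mathcal M^k_{kn}$ be the set of all of them. Two perfect hypermatchings $m,m'$ \emph{partially 2-intersect} if there are $e\in m$ and $e'\in m'$ with $|e\cap e'|\ge 2$. A family $\mathcal F\subseteq \mathcal M^k_{kn}$ is \emph{partially 2-intersecting} if every two of its members partially 2-intersect. For distinct $i,j\in[kn]$ let $$\mathcal F_{ij}=\{m\in\mathcal M^k_{kn} : \{i,j\}\subseteq e \text{ for some } e\in m\}.$$ \textbf{Theorem.} For every $k\ge 2$ there is an $n_0=n_0(k)$ such that for all $n\ge n_0$ the following holds: if $\mathcal F\subseteq\mathcal M^k_{kn}$ is a partially 2-intersecting family of maximum cardinality among all partially 2-intersecting families in $\mathcal M^k_{kn}$, then $\mathcal F=\mathcal F_{ij}$ for some distinct $i,j\in[kn]$. -/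

import Mathlib

/-- `m` is a perfect matching of the complete `k`-uniform hypergraph on the vertex set `V`:
a set of pairwise disjoint `k`-subsets of `V` that cover `V`. -/
def IsPerfectHypermatching {V : Type*} (k : ℕ) (m : Finset (Finset V)) : Prop :=
  (∀ e ∈ m, e.card = k) ∧
  (∀ e ∈ m, ∀ e' ∈ m, e ≠ e' → Disjoint e e') ∧
  (∀ v : V, ∃ e ∈ m, v ∈ e)

open Classical in
/-- The set of all perfect hypermatchings of the complete `k`-uniform hypergraph on `k * n`
vertices. -/
noncomputable def perfectHypermatchings (k n : ℕ) : Finset (Finset (Finset (Fin (k * n)))) :=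
  Finset.univ.filter (fun m => IsPerfectHypermatching k m)

/-- Two hypermatchings partially 2-intersect if some edge of the first and some edge of the
second share at least two vertices. -/
def Partially2Intersect {V : Type*} [DecidableEq V] (m m' : Finset (Finset V)) : Prop :=
  ∃ e ∈ m, ∃ e' ∈ m', 2 ≤ (e ∩ e').card

/-- A family of perfect hypermatchings any two members of which partially 2-intersect. -/
def IsPartially2IntersectingFamily (k n : ℕ)
    (F : Finset (Finset (Finset (Fin (k * n))))) : Prop :=
  F ⊆ perfectHypermatchings k n ∧ ∀ m ∈ F, ∀ m' ∈ F, Partially2Intersect m m'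

/-- A partially 2-intersecting family of maximum cardinality. -/
def IsLargestPartially2IntersectingFamily (k n : ℕ)
    (F : Finset (Finset (Finset (Fin (k * n))))) : Prop :=
  IsPartially2IntersectingFamily k n F ∧
  ∀ G : Finset (Finset (Finset (Fin (k * n)))),
    IsPartially2IntersectingFamily k n G → G.card ≤ F.card

open Classical in
/-- The family of perfect hypermatchings having an edge that contains both `i` and `j`. -/
noncomputable def canonicalFamily (k n : ℕ) (i j : Fin (k * n)) :
    Finset (Finset (Finset (Fin (k * n)))) :=
  (perfectHypermatchings k n).filter (fun m => ∃ e ∈ m, i ∈ e ∧ j ∈ e)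

/-! Two hypermatchings partially 2-intersect exactly when their sets of `pairs` meet, so the claim
is an Erdős–Ko–Rado statement for families of pair sets. The extremal candidates are the stars, one
for each pair `x`. All stars have the same size `s`, which lies between a `1/(kn)` and a `1/n`
fraction of all hypermatchings.

The engine is a pseudorandomness argument. Let `F₁`, `F₂` be families whose members contain fixed
small sets of edges (cores) `S₁`, `S₂`, and suppose each family is global: prescribing boundedly
many pairs away from its core raises their frequency by a factor of at most `1 + ε` over the uniform
one. Then the low factorial moments of the overlap between a random member of `F₁` and one of `F₂`
nearly agree with those of two uniform hypermatchings. By Bonferroni's inequalities the probability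
of an empty overlap is nearly the uniform one, which a switching argument bounds away from zero. So
if the cores share no pair, some two members share none (`exists_disjoint_of_isGlobal`).

Any subfamily `G` of an intersecting `F` with more than a `1/(Ln)` proportion of all hypermatchings
contains a global piece with a core of at most `q` edges, where `q` has order at most `√n`
(`exists_spread_subfamily`, `isGlobal_of_spread`). Hence the cores of any two such subfamilies share
a pair (`exists_cores`).

To finish (`exists_eq_star`), suppose that for every pair `x` the part of `F` avoiding `x` is large.
Then outside a small remainder each member contains a pair `x` of the core of `F` and a pair `y ≠ x`
of the core of the part avoiding `x`. There are at most `(k²q)²` such choices, each covering at most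
`s/n` members, so `F` would be smaller than a star. Thus some star contains all but a small part of
`F`. A single member outside that star would be disjoint in pairs from a constant proportion of the
star, which costs more than the small part can repay; so `F` lies in the star and, being maximum,
equals it. -/

set_option linter.unusedSectionVars false

open Finset
open scoped Pointwise

section

variable {V : Type*} [DecidableEq V]

/-! ### Pairs covered by a hypermatching, and the action of permutations -/

/-- `u` and `v` lie in a common edge of `m`. -/
def SameEdge (m : Finset (Finset V)) (u v : V) : Prop := ∃ e ∈ m, u ∈ e ∧ v ∈ e

instance (m : Finset (Finset V)) (u v : V) : Decidable (SameEdge m u v) :=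
  inferInstanceAs (Decidable (∃ e ∈ m, u ∈ e ∧ v ∈ e))

/-- The two-element sets contained in an edge of `m`. -/
def pairs (m : Finset (Finset V)) : Finset (Finset V) := m.biUnion (fun e => e.powersetCard 2)

theorem mem_pairs {m : Finset (Finset V)} {x : Finset V} :
    x ∈ pairs m ↔ ∃ e ∈ m, x ⊆ e ∧ x.card = 2 := by
  simp [pairs, mem_powersetCard]

theorem pairs_mono {m m' : Finset (Finset V)} (h : m ⊆ m') : pairs m ⊆ pairs m' :=
  biUnion_subset_biUnion_of_subset_left _ h

theorem pair_mem_pairs {m : Finset (Finset V)} {u v : V} :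
    ({u, v} : Finset V) ∈ pairs m ↔ u ≠ v ∧ SameEdge m u v := by
  rw [mem_pairs]
  constructor
  · rintro ⟨e, he, hs, hc⟩
    refine ⟨fun h => by simp [h] at hc, e, he, hs (by simp), hs (by simp)⟩
  · rintro ⟨h, e, he, hu, hv⟩
    exact ⟨e, he, by simp [insert_subset_iff, hu, hv], card_pair h⟩

theorem partially2Intersect_iff {m m' : Finset (Finset V)} :
    Partially2Intersect m m' ↔ ¬ Disjoint (pairs m) (pairs m') := by
  rw [not_disjoint_iff]
  constructor
  · rintro ⟨e, he, e', he', h⟩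
    obtain ⟨x, hx, hc⟩ := exists_subset_card_eq h
    exact ⟨x, mem_pairs.2 ⟨e, he, hx.trans inter_subset_left, hc⟩,
      mem_pairs.2 ⟨e', he', hx.trans inter_subset_right, hc⟩⟩
  · rintro ⟨x, h1, h2⟩
    obtain ⟨e, he, hs, hc⟩ := mem_pairs.1 h1
    obtain ⟨e', he', hs', -⟩ := mem_pairs.1 h2
    exact ⟨e, he, e', he', hc ▸ card_le_card (subset_inter hs hs')⟩

theorem SameEdge.symm {m : Finset (Finset V)} {u v : V} (h : SameEdge m u v) :
    SameEdge m v u := by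
  obtain ⟨e, he, hu, hv⟩ := h
  exact ⟨e, he, hv, hu⟩

namespace IsPerfectHypermatching

variable {k : ℕ} {m : Finset (Finset V)}

theorem edge_unique (h : IsPerfectHypermatching k m) {e e' : Finset V} (he : e ∈ m) (he' : e' ∈ m)
    {v : V} (hv : v ∈ e) (hv' : v ∈ e') : e = e' := by
  by_contra hne
  exact disjoint_left.1 (h.2.1 e he e' he' hne) hv hv'

theorem same_refl (h : IsPerfectHypermatching k m) (v : V) : SameEdge m v v := by
  obtain ⟨e, he, hv⟩ := h.2.2 v
  exact ⟨e, he, hv, hv⟩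

theorem card_same [Fintype V] (h : IsPerfectHypermatching k m) (v : V) :
    (univ.filter (fun u => SameEdge m v u)).card = k := by
  obtain ⟨e, he, hv⟩ := h.2.2 v
  rw [← h.1 e he]
  congr 1
  ext u
  simp only [mem_filter, mem_univ, true_and]
  constructor
  · rintro ⟨e', he', hv', hu⟩
    rwa [h.edge_unique he he' hv hv']
  · intro hu
    exact ⟨e, he, hv, hu⟩

theorem smul (h : IsPerfectHypermatching k m) (σ : Equiv.Perm V) :
    IsPerfectHypermatching k (σ • m) := by
  refine ⟨?_, ?_, ?_⟩
  · intro e he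
    obtain ⟨f, hf, rfl⟩ := mem_smul_finset.1 he
    rw [card_smul_finset, h.1 f hf]
  · intro e he e' he' hne
    obtain ⟨f, hf, rfl⟩ := mem_smul_finset.1 he
    obtain ⟨f', hf', rfl⟩ := mem_smul_finset.1 he'
    rw [smul_finset_def, smul_finset_def, disjoint_image (MulAction.injective σ)]
    exact h.2.1 f hf f' hf' (fun h => hne (by rw [h]))
  · intro v
    obtain ⟨e, he, hv⟩ := h.2.2 (σ⁻¹ • v)
    exact ⟨σ • e, smul_mem_smul_finset he, by rwa [← inv_smul_mem_iff]⟩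

end IsPerfectHypermatching

theorem sameEdge_smul {m : Finset (Finset V)} {σ : Equiv.Perm V} {u v : V} :
    SameEdge (σ • m) u v ↔ SameEdge m (σ⁻¹ u) (σ⁻¹ v) := by
  constructor
  · rintro ⟨e, he, hu, hv⟩
    obtain ⟨f, hf, rfl⟩ := mem_smul_finset.1 he
    exact ⟨f, hf, inv_smul_mem_iff.2 hu, inv_smul_mem_iff.2 hv⟩
  · rintro ⟨e, he, hu, hv⟩
    exact ⟨σ • e, smul_mem_smul_finset he, inv_smul_mem_iff.1 hu, inv_smul_mem_iff.1 hv⟩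

theorem pairs_smul (σ : Equiv.Perm V) (m : Finset (Finset V)) :
    pairs (σ • m) = σ • pairs m := by
  ext x
  rw [← inv_smul_mem_iff, mem_pairs, mem_pairs]
  constructor
  · rintro ⟨e, he, hx, hc⟩
    obtain ⟨f, hf, rfl⟩ := mem_smul_finset.1 he
    refine ⟨f, hf, ?_, by rwa [card_smul_finset]⟩
    rwa [← smul_finset_subset_smul_finset_iff (a := σ), smul_inv_smul]
  · rintro ⟨e, he, hx, hc⟩
    rw [card_smul_finset] at hc
    refine ⟨σ • e, smul_mem_smul_finset he, ?_, hc⟩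
    rwa [← smul_finset_subset_smul_finset_iff (a := σ), smul_inv_smul] at hx

theorem disjoint_pairs_iff {m m' : Finset (Finset V)} :
    Disjoint (pairs m) (pairs m') ↔ ∀ u v, u ≠ v → SameEdge m u v → ¬ SameEdge m' u v := by
  rw [disjoint_left]
  constructor
  · intro h u v huv h1 h2
    exact h (pair_mem_pairs.2 ⟨huv, h1⟩) (pair_mem_pairs.2 ⟨huv, h2⟩)
  · intro h x h1 h2
    obtain ⟨e, -, -, hc⟩ := mem_pairs.1 h1
    obtain ⟨u, v, huv, rfl⟩ := card_eq_two.1 hc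
    exact h u v huv (pair_mem_pairs.1 h1).2 (pair_mem_pairs.1 h2).2

/-! ### The space of hypermatchings and transitivity of the symmetric group -/

open Classical in
/-- The set of all perfect hypermatchings of the complete `k`-uniform hypergraph on `V`. -/
noncomputable def hypermatchings (k : ℕ) (V : Type*) [Fintype V] : Finset (Finset (Finset V)) :=
  univ.filter (fun m => IsPerfectHypermatching k m)

variable [Fintype V] {k : ℕ}

theorem mem_hypermatchings {m : Finset (Finset V)} :
    m ∈ hypermatchings k V ↔ IsPerfectHypermatching k m := by
  simp [hypermatchings]

theorem smul_mem_hypermatchings {m : Finset (Finset V)} {σ : Equiv.Perm V} :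
    σ • m ∈ hypermatchings k V ↔ m ∈ hypermatchings k V := by
  rw [mem_hypermatchings, mem_hypermatchings]
  refine ⟨fun h => ?_, fun h => h.smul σ⟩
  have := h.smul σ⁻¹
  rwa [inv_smul_smul] at this

/-- The permutation taking one set to another of the same size can be chosen to fix everything
outside the two sets. -/
theorem exists_perm_smul_eq {A B : Finset V} (h : A.card = B.card) :
    ∃ σ : Equiv.Perm V, σ • A = B ∧ ∀ v, v ∉ A → v ∉ B → σ v = v := by
  induction hd : (A \ B).card using Nat.strong_induction_on generalizing A with
  | _ d ih =>
    rcases Nat.eq_zero_or_pos d with h0 | h0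
    · rw [h0, card_eq_zero, sdiff_eq_empty_iff_subset] at hd
      exact ⟨1, by rw [one_smul]; exact eq_of_subset_of_card_le hd h.ge, by simp⟩
    · have hBA : (B \ A).card = (A \ B).card := by
        have h1 := card_sdiff_add_card_inter A B
        have h2 := card_sdiff_add_card_inter B A
        rw [inter_comm] at h2
        omega
      obtain ⟨a, ha⟩ := card_pos.1 (hd ▸ h0)
      obtain ⟨b, hb⟩ := card_pos.1 (hBA ▸ hd ▸ h0)
      rw [mem_sdiff] at ha hb
      have hA' : ∀ x, x ∈ Equiv.swap a b • A ↔ x = b ∨ (x ∈ A ∧ x ≠ a) := by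
        intro x
        rw [← inv_smul_mem_iff, Equiv.swap_inv, Equiv.Perm.smul_def]
        rcases eq_or_ne x a with rfl | hxa
        · rw [Equiv.swap_apply_left]
          have : x ≠ b := fun h => hb.2 (h ▸ ha.1)
          simp [hb.2, this]
        rcases eq_or_ne x b with rfl | hxb
        · simp [ha.1]
        · rw [Equiv.swap_apply_of_ne_of_ne hxa hxb]
          simp [hxa, hxb]
      obtain ⟨σ, hσ, hf⟩ := ih ((Equiv.swap a b • A) \ B).card (by
          rw [← hd]
          refine card_lt_card ⟨fun x hx => ?_, fun hss => ?_⟩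
          · rw [mem_sdiff, hA'] at hx
            rcases hx with ⟨rfl | h1, h2⟩
            · exact absurd hb.1 h2
            · exact mem_sdiff.2 ⟨h1.1, h2⟩
          · have := hss (mem_sdiff.2 ha)
            rw [mem_sdiff, hA'] at this
            rcases this.1 with h1 | h1
            · exact ha.2 (h1 ▸ hb.1)
            · exact h1.2 rfl) (by rw [card_smul_finset, h]) rfl
      refine ⟨σ * Equiv.swap a b, by rw [mul_smul, hσ], fun v hA hB => ?_⟩
      have hva : v ≠ a := fun h => hA (h ▸ ha.1)
      have hvb : v ≠ b := fun h => hB (h ▸ hb.1)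
      rw [Equiv.Perm.mul_apply, Equiv.swap_apply_of_ne_of_ne hva hvb]
      exact hf v (by rw [hA']; simp [hvb, hA]) hB

theorem smul_eq_self_of_forall {σ : Equiv.Perm V} {e : Finset V} (h : ∀ v ∈ e, σ v = v) :
    σ • e = e := by
  rw [smul_finset_def]
  ext x
  simp only [mem_image, Equiv.Perm.smul_def]
  constructor
  · rintro ⟨y, hy, rfl⟩
    rwa [h y hy]
  · exact fun hx => ⟨x, hx, h x hx⟩

/-- The set of vertices covered by a set of edges. -/
def vertexSet (E : Finset (Finset V)) : Finset V := E.biUnion (fun e => e)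

theorem mem_vertexSet {E : Finset (Finset V)} {v : V} : v ∈ vertexSet E ↔ ∃ e ∈ E, v ∈ e := by
  simp [vertexSet]

namespace IsPerfectHypermatching

variable {m m' : Finset (Finset V)}

theorem card_vertexSet (h : IsPerfectHypermatching k m) {E : Finset (Finset V)} (hE : E ⊆ m) :
    (vertexSet E).card = k * E.card := by
  rw [vertexSet, card_biUnion (fun e he e' he' hne => h.2.1 e (hE he) e' (hE he') hne),
    sum_congr rfl (fun e he => h.1 e (hE he)), sum_const, smul_eq_mul, mul_comm]

theorem card_eq (h : IsPerfectHypermatching k m) : k * m.card = Fintype.card V := by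
  rw [← h.card_vertexSet subset_rfl, ← card_univ]
  congr 1
  ext v
  simp only [mem_vertexSet, mem_univ, iff_true]
  exact h.2.2 v

/-- The symmetric group acts transitively on perfect hypermatchings. -/
theorem exists_smul_eq (hk : 0 < k) (h : IsPerfectHypermatching k m)
    (h' : IsPerfectHypermatching k m') : ∃ σ : Equiv.Perm V, σ • m = m' := by
  induction hd : (m \ m').card using Nat.strong_induction_on generalizing m with
  | _ d ih =>
    have hmm : m.card = m'.card :=
      Nat.eq_of_mul_eq_mul_left hk (h.card_eq.trans h'.card_eq.symm)
    rcases Nat.eq_zero_or_pos d with h0 | h0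
    · rw [h0, card_eq_zero, sdiff_eq_empty_iff_subset] at hd
      exact ⟨1, by rw [one_smul]; exact eq_of_subset_of_card_le hd hmm.ge⟩
    · have hBA : (m' \ m).card = (m \ m').card := by
        have h1 := card_sdiff_add_card_inter m m'
        have h2 := card_sdiff_add_card_inter m' m
        rw [inter_comm] at h2
        omega
      obtain ⟨e, he⟩ := card_pos.1 (hd ▸ h0)
      obtain ⟨e', he'⟩ := card_pos.1 (hBA ▸ hd ▸ h0)
      rw [mem_sdiff] at he he'
      obtain ⟨σ, hσ, hf⟩ := exists_perm_smul_eq ((h.1 e he.1).trans (h'.1 e' he'.1).symm)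
      -- An edge common to `m` and `m'` is disjoint from both `e` and `e'`, so `σ` fixes it: moving
      -- `e` onto `e'` loses no agreement already reached.
      have hsub : (σ • m) \ m' ⊆ ((m \ m').erase e).image (fun g => σ • g) := by
        intro f hfm
        rw [mem_sdiff] at hfm
        obtain ⟨g, hg, rfl⟩ := mem_smul_finset.1 hfm.1
        have hge : g ≠ e := by
          rintro rfl
          exact hfm.2 (hσ ▸ he'.1)
        refine mem_image_of_mem _ (mem_erase.2 ⟨hge, mem_sdiff.2 ⟨hg, fun hg' => hfm.2 ?_⟩⟩)
        rwa [smul_eq_self_of_forall]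
        intro v hv
        refine hf v (fun hve => hge (h.edge_unique hg he.1 hv hve)) (fun hve => ?_)
        have := h'.edge_unique hg' he'.1 hv hve
        exact he'.2 (this ▸ hg)
      have hlt : ((σ • m) \ m').card < d := by
        have h1 := (card_le_card hsub).trans card_image_le
        have h2 := card_erase_lt_of_mem (mem_sdiff.2 he)
        omega
      obtain ⟨τ, hτ⟩ := ih _ hlt (h.smul σ) rfl
      exact ⟨τ * σ, by rw [mul_smul, hτ]⟩

end IsPerfectHypermatching

theorem sum_hypermatchings_smul {β : Type*} [AddCommMonoid β] (σ : Equiv.Perm V)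
    (f : Finset (Finset V) → β) :
    ∑ m ∈ hypermatchings k V, f (σ • m) = ∑ m ∈ hypermatchings k V, f m :=
  sum_equiv (MulAction.toPerm σ) (fun m => by
    rw [MulAction.toPerm_apply, smul_mem_hypermatchings]) (fun _ _ => rfl)

/-! ### Switching: random transpositions destroy common pairs -/

/-- The vertices outside `A` that share an edge of `m` and an edge of `m'` with a common other
vertex. -/
def badVertices (m m' : Finset (Finset V)) (A : Finset V) : Finset V :=
  univ.filter (fun v => v ∉ A ∧ ∃ u, u ≠ v ∧ SameEdge m v u ∧ SameEdge m' v u)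

theorem mem_badVertices {m m' : Finset (Finset V)} {A : Finset V} {v : V} :
    v ∈ badVertices m m' A ↔ v ∉ A ∧ ∃ u, u ≠ v ∧ SameEdge m v u ∧ SameEdge m' v u := by
  simp [badVertices]

/-- Exchanging `v` and `w` in `m'` creates no common pair of `m` and `m'` at `v` or `w`. -/
def IsSwitch (m m' : Finset (Finset V)) (v w : V) : Prop :=
  (∀ u, u ≠ w → SameEdge m w u → ¬ SameEdge m' v u) ∧
  (∀ u, u ≠ v → SameEdge m v u → ¬ SameEdge m' w u)

instance (m m' : Finset (Finset V)) (v w : V) : Decidable (IsSwitch m m' v w) :=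
  inferInstanceAs (Decidable (_ ∧ _))

section Switch

variable {m m' : Finset (Finset V)} {A : Finset V} {v w : V}

theorem sameEdge_swap_smul {x y : V} :
    SameEdge (Equiv.swap v w • m) x y ↔
      SameEdge m (Equiv.swap v w x) (Equiv.swap v w y) := by
  rw [sameEdge_smul, Equiv.swap_inv]

theorem IsSwitch.good_left (h' : IsPerfectHypermatching k m') (hs : IsSwitch m m' v w)
    {u : V} (hu : u ≠ v) (h1 : SameEdge m v u) : ¬ SameEdge (Equiv.swap v w • m') v u := by
  rw [sameEdge_swap_smul, Equiv.swap_apply_left]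
  rcases eq_or_ne u w with rfl | huw
  · exact absurd (h'.same_refl u) (hs.2 u hu h1)
  · rw [Equiv.swap_apply_of_ne_of_ne hu huw]
    exact hs.2 u hu h1

theorem IsSwitch.symm (hs : IsSwitch m m' v w) : IsSwitch m m' w v := ⟨hs.2, hs.1⟩

theorem IsSwitch.good_right (h' : IsPerfectHypermatching k m') (hs : IsSwitch m m' v w)
    {u : V} (hu : u ≠ w) (h1 : SameEdge m w u) : ¬ SameEdge (Equiv.swap v w • m') w u := by
  rw [Equiv.swap_comm]
  exact hs.symm.good_left h' hu h1

/-- Pairs that avoid `v` and `w` are unaffected by the exchange, and the switch condition rules out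
common pairs at `v` or `w`. So nothing becomes bad, and `v` becomes good. -/
theorem IsSwitch.badVertices_subset (h' : IsPerfectHypermatching k m') (hs : IsSwitch m m' v w) :
    badVertices m (Equiv.swap v w • m') A ⊆ (badVertices m m' A).erase v := by
  intro z hz
  obtain ⟨hzA, u, huz, h1, h2⟩ := mem_badVertices.1 hz
  have hzv : z ≠ v := by
    rintro rfl
    exact hs.good_left h' huz h1 h2
  have hzw : z ≠ w := by
    rintro rfl
    exact hs.good_right h' huz h1 h2
  have huv : u ≠ v := by
    rintro rfl
    exact hs.good_left h' hzv h1.symm h2.symm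
  have huw : u ≠ w := by
    rintro rfl
    exact hs.good_right h' hzw h1.symm h2.symm
  rw [sameEdge_swap_smul, Equiv.swap_apply_of_ne_of_ne hzv hzw,
    Equiv.swap_apply_of_ne_of_ne huv huw] at h2
  exact mem_erase.2 ⟨hzv, mem_badVertices.2 ⟨hzA, u, huz, h1, h2⟩⟩

/-- Only vertices in the two `m'`-edges through `v` and `w` can stop being bad, which limits the
drop caused by one exchange to `2 * k`. -/
theorem card_badVertices_le (h' : IsPerfectHypermatching k m') :
    (badVertices m m' A).card ≤ (badVertices m (Equiv.swap v w • m') A).card + 2 * k := by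
  have hsub : badVertices m m' A ⊆ badVertices m (Equiv.swap v w • m') A ∪
      (univ.filter (fun u => SameEdge m' v u) ∪ univ.filter (fun u => SameEdge m' w u)) := by
    intro z hz
    obtain ⟨hzA, u, huz, h1, h2⟩ := mem_badVertices.1 hz
    simp only [mem_union, mem_filter, mem_univ, true_and]
    by_contra hcon
    push Not at hcon
    obtain ⟨hb, hv, hw⟩ := hcon
    have hzv : z ≠ v := by
      rintro rfl
      exact hv (h'.same_refl z)
    have hzw : z ≠ w := by
      rintro rfl
      exact hw (h'.same_refl z)
    have huv : u ≠ v := by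
      rintro rfl
      exact hv h2.symm
    have huw : u ≠ w := by
      rintro rfl
      exact hw h2.symm
    refine hb (mem_badVertices.2 ⟨hzA, u, huz, h1, ?_⟩)
    rwa [sameEdge_swap_smul, Equiv.swap_apply_of_ne_of_ne hzv hzw,
      Equiv.swap_apply_of_ne_of_ne huv huw]
  refine (card_le_card hsub).trans ((card_union_le _ _).trans ?_)
  have := card_union_le (univ.filter (fun u => SameEdge m' v u))
    (univ.filter (fun u => SameEdge m' w u))
  rw [h'.card_same, h'.card_same] at this
  omega

theorem card_biUnion_same_le {m₁ m₂ : Finset (Finset V)} (h₁ : IsPerfectHypermatching k m₁)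
    (h₂ : IsPerfectHypermatching k m₂) (v : V) :
    ((univ.filter (fun u => SameEdge m₁ v u)).biUnion
      (fun u => univ.filter (fun w => SameEdge m₂ u w))).card ≤ k * k := by
  refine card_biUnion_le.trans ?_
  rw [sum_congr rfl (fun u _ => h₂.card_same u), sum_const, h₁.card_same, smul_eq_mul]

/-- A vertex outside `A` fails to be a switch partner of `v` only if it is reached from `v` by a
step inside an edge of one hypermatching followed by a step in the other. There are at most `k * k`
such vertices for each order of the steps. -/
theorem card_isSwitch_ge (h : IsPerfectHypermatching k m) (h' : IsPerfectHypermatching k m') :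
    Fintype.card V ≤ (univ.filter (fun w => w ∉ A ∧ IsSwitch m m' v w)).card +
      (2 * (k * k) + A.card) := by
  have hsub : (univ : Finset V) ⊆ univ.filter (fun w => w ∉ A ∧ IsSwitch m m' v w) ∪
      ((((univ.filter (fun u => SameEdge m' v u)).biUnion
        (fun u => univ.filter (fun w => SameEdge m u w))) ∪
      ((univ.filter (fun u => SameEdge m v u)).biUnion
        (fun u => univ.filter (fun w => SameEdge m' u w)))) ∪ A) := by
    intro w _
    simp only [mem_union, mem_filter, mem_univ, true_and, mem_biUnion]
    by_contra hcon
    push Not at hcon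
    obtain ⟨h1, ⟨h2, h3⟩, h4⟩ := hcon
    exact h1 h4 ⟨fun u _ hw hv => h2 u hv hw.symm, fun u _ hv hw => h3 u hv hw.symm⟩
  have h1 := (card_le_card hsub).trans (card_union_le _ _)
  have h2 := card_union_le ((((univ.filter (fun u => SameEdge m' v u)).biUnion
        (fun u => univ.filter (fun w => SameEdge m u w))) ∪
      ((univ.filter (fun u => SameEdge m v u)).biUnion
        (fun u => univ.filter (fun w => SameEdge m' u w))))) A
  have h3 := card_union_le ((univ.filter (fun u => SameEdge m' v u)).biUnion
        (fun u => univ.filter (fun w => SameEdge m u w)))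
      ((univ.filter (fun u => SameEdge m v u)).biUnion
        (fun u => univ.filter (fun w => SameEdge m' u w)))
  have h4 := card_biUnion_same_le h' h v
  have h5 := card_biUnion_same_le h h' v
  rw [card_univ] at h1
  omega

/-- The reverse count: if `v` is bad after the exchange, then `w` lies in the `m'`-edge of some
vertex in the `m`-edge of `v`. -/
theorem card_bad_swap_le (h : IsPerfectHypermatching k m) (h' : IsPerfectHypermatching k m') :
    (univ.filter (fun w => v ∈ badVertices m (Equiv.swap v w • m') A)).card ≤ k * k := by
  refine le_trans (card_le_card ?_) (card_biUnion_same_le h h' v)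
  intro w hw
  obtain ⟨-, u, huv, h1, h2⟩ := mem_badVertices.1 (mem_filter.1 hw).2
  simp only [mem_filter, mem_univ, true_and, mem_biUnion]
  rcases eq_or_ne u w with rfl | huw
  · exact ⟨u, h1, h'.same_refl u⟩
  · rw [sameEdge_swap_smul, Equiv.swap_apply_left, Equiv.swap_apply_of_ne_of_ne huv huw] at h2
    exact ⟨u, h1, h2.symm⟩

end Switch

/-- The switching inequality: in a family of hypermatchings closed under exchanging vertices outside
`A`, the number of vertices that are bad with respect to `m` tends to drop. -/
theorem sum_badVertices_le {m : Finset (Finset V)} {A : Finset V} {M : Finset (Finset (Finset V))}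
    (h : IsPerfectHypermatching k m) (hM : M ⊆ hypermatchings k V)
    (hclosed : ∀ m' ∈ M, ∀ v w, v ∉ A → w ∉ A → Equiv.swap v w • m' ∈ M)
    (hV : 2 * (2 * (k * k) + A.card) ≤ Fintype.card V) {f g : ℕ → ℝ} (hf : ∀ s, 0 ≤ f s)
    (hg : ∀ s, 0 ≤ g s) (hfg : ∀ s s', s' < s → s ≤ s' + 2 * k → f s ≤ g s') :
    ∑ m' ∈ M, ((badVertices m m' A).card : ℝ) * f (badVertices m m' A).card ≤
      2 * (k * k) * ∑ m' ∈ M, g (badVertices m m' A).card := by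
  rcases Nat.eq_zero_or_pos (Fintype.card V) with h0 | hpos
  · have : ∀ m', (badVertices m m' A).card = 0 := fun m' => by
      have := card_le_univ (badVertices m m' A)
      omega
    simp only [this, Nat.cast_zero, zero_mul, sum_const_zero]
    have := hg 0
    positivity
  have hposR : (0 : ℝ) < Fintype.card V := by exact_mod_cast hpos
  -- Double counting of triples `(m', v, w)` with `v` bad and `w ∉ A` a switch partner, weighted by
  -- `f (s m')`. Each bad `v` has at least `|V| / 2` partners by `hV`.
  set s : Finset (Finset V) → ℕ := fun m' => (badVertices m m' A).card with hs
  have hPM : ∀ m' ∈ M, IsPerfectHypermatching k m' := fun m' hm' => mem_hypermatchings.1 (hM hm')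
  -- forward count
  have hfor : ∀ m' ∈ M, (Fintype.card V : ℝ) / 2 * ((s m' : ℝ) * f (s m')) ≤
      ∑ v, ∑ w, if v ∈ badVertices m m' A ∧ w ∉ A ∧ IsSwitch m m' v w then f (s m') else 0 := by
    intro m' hm'
    have h1 : ∀ v, (if v ∈ badVertices m m' A then (Fintype.card V : ℝ) / 2 * f (s m') else 0) ≤
        ∑ w, if v ∈ badVertices m m' A ∧ w ∉ A ∧ IsSwitch m m' v w then f (s m') else 0 := by
      intro v
      by_cases hv : v ∈ badVertices m m' A
      · simp only [hv, if_true, true_and]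
        rw [← sum_filter, sum_const, nsmul_eq_mul]
        refine mul_le_mul_of_nonneg_right ?_ (hf _)
        have := card_isSwitch_ge (A := A) (v := v) h (hPM m' hm')
        have h2 : Fintype.card V ≤
            2 * (univ.filter (fun w => w ∉ A ∧ IsSwitch m m' v w)).card := by omega
        have h3 : (Fintype.card V : ℝ) ≤
            2 * (univ.filter (fun w => w ∉ A ∧ IsSwitch m m' v w)).card := by exact_mod_cast h2
        linarith
      · simp [hv]
    refine le_trans (le_of_eq ?_) (sum_le_sum (fun v _ => h1 v))
    rw [← sum_filter, sum_const, nsmul_eq_mul, filter_mem_eq_inter, univ_inter]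
    ring
  -- Index the triples by the switched hypermatching instead. Exchanging back recovers `m'` and
  -- makes `v` bad again, so for each `v` at most `k * k` vertices `w` occur; `hfg` converts the
  -- weights, since the bad count has dropped by between 1 and `2 * k`.
  have hback : ∑ m' ∈ M, ∑ v, ∑ w,
      (if v ∈ badVertices m m' A ∧ w ∉ A ∧ IsSwitch m m' v w then f (s m') else 0) ≤
      Fintype.card V * (k * k) * ∑ m' ∈ M, g (s m') := by
    have h1 : ∀ v w, ∑ m' ∈ M,
        (if v ∈ badVertices m m' A ∧ w ∉ A ∧ IsSwitch m m' v w then f (s m') else 0) ≤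
        ∑ m' ∈ M, if v ∈ badVertices m (Equiv.swap v w • m') A then g (s m') else 0 := by
      intro v w
      rw [← sum_filter, ← sum_filter]
      have hnn : ∀ m', 0 ≤ g (s m') := fun _ => hg _
      calc ∑ m' ∈ M with v ∈ badVertices m m' A ∧ w ∉ A ∧ IsSwitch m m' v w, f (s m')
          ≤ ∑ m' ∈ M with v ∈ badVertices m m' A ∧ w ∉ A ∧ IsSwitch m m' v w,
            g (s (Equiv.swap v w • m')) := by
            refine sum_le_sum fun m' hm' => ?_
            obtain ⟨hm', hv, -, hsw⟩ := mem_filter.1 hm'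
            refine hfg _ _ ?_ (card_badVertices_le (hPM m' hm'))
            refine lt_of_le_of_lt (card_le_card (hsw.badVertices_subset (hPM m' hm'))) ?_
            exact card_erase_lt_of_mem hv
        _ = ∑ m' ∈ (M.filter (fun m' => v ∈ badVertices m m' A ∧ w ∉ A ∧ IsSwitch m m' v w)).image
              (fun m' => Equiv.swap v w • m'), g (s m') := by
            rw [sum_image]
            intro a _ b _ hab
            exact MulAction.injective _ hab
        _ ≤ _ := by
            refine sum_le_sum_of_subset_of_nonneg ?_ (fun m' _ _ => hnn m')
            intro m'' hm''
            obtain ⟨m', hm', rfl⟩ := mem_image.1 hm''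
            obtain ⟨hm', hv, hw, -⟩ := mem_filter.1 hm'
            refine mem_filter.2 ⟨hclosed m' hm' v w (mem_badVertices.1 hv).1 hw, ?_⟩
            rwa [smul_smul, Equiv.swap_mul_self, one_smul]
    calc _ = ∑ v, ∑ w, ∑ m' ∈ M,
        (if v ∈ badVertices m m' A ∧ w ∉ A ∧ IsSwitch m m' v w then f (s m') else 0) := by
          rw [sum_comm]
          exact sum_congr rfl fun v _ => sum_comm
      _ ≤ ∑ v, ∑ w, ∑ m' ∈ M,
          if v ∈ badVertices m (Equiv.swap v w • m') A then g (s m') else 0 :=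
          sum_le_sum fun v _ => sum_le_sum fun w _ => h1 v w
      _ = ∑ v, ∑ m' ∈ M, ∑ w,
          if v ∈ badVertices m (Equiv.swap v w • m') A then g (s m') else 0 :=
          sum_congr rfl fun v _ => sum_comm
      _ ≤ ∑ v : V, ∑ m' ∈ M, (k * k : ℝ) * g (s m') := by
          refine sum_le_sum fun v _ => sum_le_sum fun m' hm' => ?_
          rw [← sum_filter, sum_const, nsmul_eq_mul]
          refine mul_le_mul_of_nonneg_right ?_ (hg _)
          exact_mod_cast card_bad_swap_le h (hPM m' hm')
      _ = _ := by
          rw [sum_const, ← mul_sum, card_univ, nsmul_eq_mul]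
          ring
  have hfin : (Fintype.card V : ℝ) / 2 * ∑ m' ∈ M, (s m' : ℝ) * f (s m') ≤
      Fintype.card V * (k * k) * ∑ m' ∈ M, g (s m') := by
    rw [mul_sum]
    exact (sum_le_sum hfor).trans hback
  have h2 : (Fintype.card V : ℝ) / 2 * ∑ m' ∈ M, (s m' : ℝ) * f (s m') ≤
      (Fintype.card V : ℝ) / 2 * (2 * (k * k) * ∑ m' ∈ M, g (s m')) := by
    refine hfin.trans (le_of_eq ?_)
    ring
  exact le_of_mul_le_mul_left h2 (by positivity)

/-- A bound for the exponential moments of the number of bad vertices. -/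
theorem sum_pow_badVertices_le {m : Finset (Finset V)} (h : IsPerfectHypermatching k m)
    (hV : 4 * (k * k) ≤ Fintype.card V) {z : ℕ} (hz : 1 ≤ z) :
    ∑ m' ∈ hypermatchings k V, (z : ℝ) ^ (badVertices m m' ∅).card ≤
      2 * (z : ℝ) ^ (4 * (k * k) * z ^ (2 * k)) * (hypermatchings k V).card := by
  have hz' : (1 : ℝ) ≤ z := by exact_mod_cast hz
  -- Twice the constant that the switching inequality gives for `f s = z ^ s`, so that half of `a *
  -- S` can be absorbed below.
  set a : ℕ := 4 * (k * k) * z ^ (2 * k) with ha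
  set M := hypermatchings k V
  set s : Finset (Finset V) → ℕ := fun m' => (badVertices m m' ∅).card with hs
  have key := sum_badVertices_le (A := ∅) (M := M) h subset_rfl
    (fun m' hm' v w _ _ => smul_mem_hypermatchings.2 hm') (by simp; omega)
    (f := fun s => (z : ℝ) ^ s) (g := fun s => (z : ℝ) ^ (2 * k) * (z : ℝ) ^ s)
    (fun s => by positivity) (fun s => by positivity) (fun s s' _ h2 => by
      rw [← pow_add]
      exact pow_le_pow_right₀ hz' (by omega))
  have hpt : ∀ m' ∈ M, (a : ℝ) * (z : ℝ) ^ s m' ≤ a * (z : ℝ) ^ a + (s m' : ℝ) * (z : ℝ) ^ s m' := by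
    intro m' _
    rcases le_total (s m') a with hle | hle
    · have := mul_le_mul_of_nonneg_left (pow_le_pow_right₀ hz' hle) (Nat.cast_nonneg (α := ℝ) a)
      have h2 : (0 : ℝ) ≤ (s m' : ℝ) * (z : ℝ) ^ s m' := by positivity
      linarith
    · have h1 : (a : ℝ) ≤ s m' := by exact_mod_cast hle
      have := mul_le_mul_of_nonneg_right h1 (by positivity : (0 : ℝ) ≤ (z : ℝ) ^ s m')
      have h2 : (0 : ℝ) ≤ (a : ℝ) * (z : ℝ) ^ a := by positivity
      linarith
  have hsum := sum_le_sum hpt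
  rw [← mul_sum, sum_add_distrib, sum_const, nsmul_eq_mul] at hsum
  simp only [← mul_sum] at key
  set S := ∑ m' ∈ M, (z : ℝ) ^ s m'
  have haz : (a : ℝ) = 4 * (k * k) * (z : ℝ) ^ (2 * k) := by
    rw [ha]; push_cast; ring
  have h3 : (a : ℝ) * S ≤ M.card * (a * (z : ℝ) ^ a) + a / 2 * S := by
    refine hsum.trans (add_le_add le_rfl (key.trans (le_of_eq ?_)))
    rw [haz]; ring
  rcases Nat.eq_zero_or_pos k with h0 | hk
  · have hVz : ∀ m', s m' = 0 := by
      intro m'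
      rw [hs]
      refine card_eq_zero.2 (eq_empty_of_forall_notMem fun v _ => ?_)
      obtain ⟨e, he, hv⟩ := h.2.2 v
      have := h.1 e he
      rw [h0, card_eq_zero] at this
      simp [this] at hv
    have hS : S = M.card := by simp [S, hVz]
    have : (1 : ℝ) ≤ 2 * (z : ℝ) ^ a := by
      have := one_le_pow₀ (n := a) hz'
      linarith
    rw [hS]
    exact le_mul_of_one_le_left (by positivity) this
  · have hapos : (0 : ℝ) < a := by
      rw [haz]; positivity
    have h4 : (a : ℝ) / 2 * S ≤ a / 2 * (2 * (z : ℝ) ^ a * M.card) := by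
      linarith
    exact le_of_mul_le_mul_left h4 (by positivity)

/-- A positive proportion of the hypermatchings in a family closed under exchanging vertices has no
bad vertices with respect to a given one. -/
theorem card_le_card_badVertices_eq_zero {m : Finset (Finset V)} {A : Finset V}
    {M : Finset (Finset (Finset V))} (h : IsPerfectHypermatching k m) (hM : M ⊆ hypermatchings k V)
    (hclosed : ∀ m' ∈ M, ∀ v w, v ∉ A → w ∉ A → Equiv.swap v w • m' ∈ M)
    (hV : 2 * (2 * (k * k) + A.card) ≤ Fintype.card V) :
    (M.card : ℝ) ≤ 2 * (1 + 2 * (k * k)) ^ (4 * (k * k)) *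
      (M.filter (fun m' => badVertices m m' A = ∅)).card := by
  set s : Finset (Finset V) → ℕ := fun m' => (badVertices m m' A).card with hs
  set D : ℝ := 2 * (k * k) with hD
  have hD0 : 0 ≤ D := by positivity
  -- Switching from level `l` into the levels below it. Iterating this bounds the number with at
  -- most `l` bad vertices by `(1 + D) ^ l` times the number with none.
  have hstep : ∀ l : ℕ, 1 ≤ l → ((M.filter (fun m' => s m' = l)).card : ℝ) ≤
      D * (M.filter (fun m' => s m' < l)).card := by
    intro l hl
    have key := sum_badVertices_le (f := fun s => if s = l then 1 else 0)
      (g := fun s => if s < l then 1 else 0) h hM hclosed hV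
      (fun s => by split_ifs <;> norm_num) (fun s => by split_ifs <;> norm_num) (by
        intro s s' h1 _
        by_cases hsl : s = l
        · simp [hsl, hsl ▸ h1]
        · simp only [hsl, if_false]
          split_ifs <;> norm_num)
    rw [sum_boole] at key
    refine le_trans ?_ key
    rw [← sum_boole]
    refine sum_le_sum fun m' _ => ?_
    by_cases hsl : s m' = l
    · have : (1 : ℝ) ≤ l := by exact_mod_cast hl
      have h2 : (badVertices m m' A).card = l := hsl
      simp [hs, h2, this]
    · have h2 : (badVertices m m' A).card ≠ l := hsl
      simp [hs, h2]
  have hB : ∀ l : ℕ, ((M.filter (fun m' => s m' < l + 1)).card : ℝ) ≤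
      (1 + D) ^ l * (M.filter (fun m' => s m' = 0)).card := by
    intro l
    induction l with
    | zero => simp
    | succ l ih =>
      have hsplit : ((M.filter (fun m' => s m' < l + 1 + 1)).card : ℝ) ≤
          (M.filter (fun m' => s m' < l + 1)).card + (M.filter (fun m' => s m' = l + 1)).card := by
        rw [← Nat.cast_add]
        refine Nat.cast_le.2 (le_trans (card_le_card ?_) (card_union_le _ _))
        intro m' hm'
        simp only [mem_union, mem_filter] at hm' ⊢
        rcases Nat.lt_succ_iff_lt_or_eq.1 hm'.2 with h1 | h1
        · exact Or.inl ⟨hm'.1, h1⟩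
        · exact Or.inr ⟨hm'.1, h1⟩
      have h1 := hstep (l + 1) (by omega)
      calc _ ≤ _ := hsplit
        _ ≤ (1 + D) * (M.filter (fun m' => s m' < l + 1)).card := by linarith
        _ ≤ (1 + D) * ((1 + D) ^ l * (M.filter (fun m' => s m' = 0)).card) := by gcongr
        _ = _ := by ring
  have hmean := sum_badVertices_le (f := fun _ => 1) (g := fun _ => 1) h hM hclosed hV
    (fun _ => zero_le_one) (fun _ => zero_le_one) (fun _ _ _ _ => le_rfl)
  simp only [mul_one, sum_const, nsmul_eq_mul] at hmean
  set L : ℕ := 4 * (k * k) with hL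
  have hLD : (L : ℝ) = 2 * D := by rw [hL, hD]; push_cast; ring
  -- Markov's inequality: the mean number of bad vertices is at most `D` and `L = 2 * D`, so at
  -- least half of `M` has at most `L` of them.
  have hmarkov : ((L : ℝ) + 1) * (M.filter (fun m' => ¬ s m' < L + 1)).card ≤ D * M.card := by
    refine le_trans ?_ hmean
    calc ((L : ℝ) + 1) * (M.filter (fun m' => ¬ s m' < L + 1)).card
        = ∑ m' ∈ M with ¬ s m' < L + 1, ((L : ℝ) + 1) := by
          rw [sum_const, nsmul_eq_mul, mul_comm]
      _ ≤ ∑ m' ∈ M with ¬ s m' < L + 1, (s m' : ℝ) := by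
          refine sum_le_sum fun m' hm' => ?_
          have := (mem_filter.1 hm').2
          have h2 : L + 1 ≤ s m' := by omega
          exact_mod_cast h2
      _ ≤ _ := sum_le_sum_of_subset_of_nonneg (filter_subset _ _) (fun _ _ _ => by positivity)
  have htot := card_filter_add_card_filter_not (s := M) (fun m' => s m' < L + 1)
  have htot' : ((M.filter (fun m' => s m' < L + 1)).card : ℝ) +
      (M.filter (fun m' => ¬ s m' < L + 1)).card = M.card := by exact_mod_cast htot
  have hx0 : (0 : ℝ) ≤ (M.filter (fun m' => ¬ s m' < L + 1)).card := by positivity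
  have hhalf : (M.filter (fun m' => ¬ s m' < L + 1)).card ≤ (M.card : ℝ) / 2 := by
    rw [hLD] at hmarkov
    by_contra hcon
    replace hcon := lt_of_not_ge hcon
    have h1 := mul_nonneg hD0 (sub_nonneg.2 hcon.le)
    have h2 : (0 : ℝ) ≤ M.card := by positivity
    linarith
  have hfin := hB L
  have heq : (M.filter (fun m' => s m' = 0)) = M.filter (fun m' => badVertices m m' A = ∅) := by
    simp only [hs, card_eq_zero]
  rw [heq] at hfin
  linarith

/-! ### Counting hypermatchings through given edges or pairs -/

theorem card_filter_hypermatchings_smul (σ : Equiv.Perm V) (p : Finset (Finset V) → Prop)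
    [DecidablePred p] :
    ((hypermatchings k V).filter (fun m => p (σ • m))).card =
      ((hypermatchings k V).filter p).card := by
  rw [card_filter, card_filter]
  exact sum_hypermatchings_smul σ (fun m => if p m then 1 else 0)

theorem card_filter_mem_powersetCard (hk : 0 < k) {U : Finset V} {v : V} (hv : v ∈ U) :
    ((U.powersetCard k).filter (fun e => v ∈ e)).card = (U.card - 1).choose (k - 1) := by
  rw [← card_erase_of_mem hv, ← card_powersetCard]
  symm
  refine card_nbij' (fun e => insert v e) (fun e => e.erase v) ?_ ?_ ?_ ?_
  · intro e he
    obtain ⟨h1, h2⟩ := mem_powersetCard.1 he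
    have hve : v ∉ e := fun h => by simpa using h1 h
    simp only [coe_filter, Set.mem_ofPred_eq, mem_powersetCard, mem_insert_self, and_true]
    refine ⟨insert_subset hv (h1.trans (erase_subset _ _)), ?_⟩
    rw [card_insert_of_notMem hve, h2]
    omega
  · intro e he
    simp only [coe_filter, Set.mem_ofPred_eq, mem_powersetCard] at he
    refine mem_powersetCard.2 ⟨erase_subset_erase _ he.1.1, ?_⟩
    rw [card_erase_of_mem he.2, he.1.2]
  · intro e he
    obtain ⟨h1, h2⟩ := mem_powersetCard.1 he
    exact erase_insert (fun h => by simpa using h1 h)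
  · intro e he
    simp only [coe_filter, Set.mem_ofPred_eq, mem_powersetCard] at he
    exact insert_erase he.2

/-- The number of hypermatchings containing a given set of edges drops by an explicit factor when
an edge is added. -/
theorem card_hypermatchings_insert (hk : 0 < k) {m : Finset (Finset V)}
    (hm : IsPerfectHypermatching k m) {E : Finset (Finset V)} (hE : E ⊆ m) {e : Finset V}
    (he : e ∈ m) (heE : e ∉ E) :
    ((hypermatchings k V).filter (fun m' => E ⊆ m')).card =
      (Fintype.card V - k * E.card - 1).choose (k - 1) *
        ((hypermatchings k V).filter (fun m' => insert e E ⊆ m')).card := by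
  obtain ⟨v, hv⟩ : e.Nonempty := card_pos.1 (by rw [hm.1 e he]; exact hk)
  set U : Finset V := univ \ vertexSet E with hU
  have hvU : v ∈ U := by
    simp only [hU, mem_sdiff, mem_univ, true_and, mem_vertexSet, not_exists, not_and]
    intro f hf hvf
    exact heE (hm.edge_unique he (hE hf) hv hvf ▸ hf)
  have hUc : U.card = Fintype.card V - k * E.card := by
    rw [hU, card_sdiff_of_subset (subset_univ _), card_univ, hm.card_vertexSet hE]
  -- Partition by the edge at `v`, a `k`-subset of the uncovered set `U`. Permutations fixing the
  -- edges of `E` carry one choice to another, so all parts are equally large.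
  have hdecomp : (hypermatchings k V).filter (fun m' => E ⊆ m') =
      ((U.powersetCard k).filter (fun e => v ∈ e)).biUnion
        (fun e => (hypermatchings k V).filter (fun m' => insert e E ⊆ m')) := by
    ext m'
    simp only [mem_filter, mem_biUnion, mem_powersetCard, insert_subset_iff]
    constructor
    · rintro ⟨hm', hEm⟩
      have hp := mem_hypermatchings.1 hm'
      obtain ⟨f, hf, hvf⟩ := hp.2.2 v
      refine ⟨f, ⟨⟨fun u hu => ?_, hp.1 f hf⟩, hvf⟩, hm', hf, hEm⟩
      simp only [hU, mem_sdiff, mem_univ, true_and, mem_vertexSet, not_exists, not_and]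
      intro g hg hug
      have := hp.edge_unique hf (hEm hg) hu hug
      subst this
      simp only [hU, mem_sdiff, mem_univ, true_and, mem_vertexSet, not_exists, not_and] at hvU
      exact hvU f hg hvf
    · rintro ⟨f, -, hm', -, hEm⟩
      exact ⟨hm', hEm⟩
  rw [hdecomp, card_biUnion, sum_congr rfl (g := fun _ =>
    ((hypermatchings k V).filter (fun m' => insert e E ⊆ m')).card), sum_const,
    card_filter_mem_powersetCard hk hvU, hUc, smul_eq_mul]
  · intro f hf
    simp only [mem_filter, mem_powersetCard] at hf
    obtain ⟨σ, hσ, hfix⟩ := exists_perm_smul_eq ((hm.1 e he).trans hf.1.2.symm)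
    have hσE : ∀ g ∈ E, σ • g = g := by
      intro g hg
      refine smul_eq_self_of_forall fun u hu => hfix u (fun hue => ?_) (fun huf => ?_)
      · exact heE (hm.edge_unique he (hE hg) hue hu ▸ hg)
      · have := hf.1.1 huf
        simp only [hU, mem_sdiff, mem_univ, true_and, mem_vertexSet, not_exists, not_and] at this
        exact this g hg hu
    rw [← card_filter_hypermatchings_smul σ]
    congr 1
    refine filter_congr fun m' _ => ?_
    simp only [insert_subset_iff]
    rw [← hσ, smul_mem_smul_finset_iff]
    refine and_congr_right fun _ => ?_
    constructor
    · intro h g hg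
      have := h hg
      rwa [← hσE g hg, smul_mem_smul_finset_iff] at this
    · intro h g hg
      rw [← hσE g hg, smul_mem_smul_finset_iff]
      exact h hg
  · intro f hf f' hf' hne
    simp only [Function.onFun]
    rw [disjoint_left]
    intro m' h1 h2
    simp only [coe_filter, Set.mem_ofPred_eq, mem_filter, insert_subset_iff] at h1 h2 hf hf'
    exact hne ((mem_hypermatchings.1 h1.1).edge_unique h1.2.1 h2.2.1 hf.2 hf'.2)

theorem card_hypermatchings_le (hk : 0 < k) {m : Finset (Finset V)}
    (hm : IsPerfectHypermatching k m) {E : Finset (Finset V)} (hE : E ⊆ m) :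
    (hypermatchings k V).card ≤ (Fintype.card V - 1).choose (k - 1) ^ E.card *
      ((hypermatchings k V).filter (fun m' => E ⊆ m')).card := by
  induction E using Finset.induction_on with
  | empty => simp
  | insert e E he ih =>
    have hEm : E ⊆ m := (subset_insert _ _).trans hE
    refine (ih hEm).trans ?_
    rw [card_hypermatchings_insert hk hm hEm (hE (mem_insert_self _ _)) he,
      card_insert_of_notMem he, pow_succ, mul_assoc]
    refine Nat.mul_le_mul_left _ (Nat.mul_le_mul_right _ ?_)
    exact Nat.choose_le_choose _ (by omega)

theorem card_filter_superset_mul_le (hk : 0 < k) {m : Finset (Finset V)}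
    (hm : IsPerfectHypermatching k m) {E : Finset (Finset V)} (hE : E ⊆ m) {q : ℕ}
    (hq : E.card ≤ q) :
    ((hypermatchings k V).filter (fun m' => E ⊆ m')).card *
      (Fintype.card V - k * q - 1).choose (k - 1) ^ E.card ≤ (hypermatchings k V).card := by
  induction E using Finset.induction_on with
  | empty => simp
  | insert e E he ih =>
    have hEm : E ⊆ m := (subset_insert _ _).trans hE
    rw [card_insert_of_notMem he] at hq
    refine le_trans ?_ (ih hEm (by omega))
    rw [card_hypermatchings_insert hk hm hEm (hE (mem_insert_self _ _)) he,
      card_insert_of_notMem he, pow_succ, mul_comm, mul_assoc, mul_comm _ (_ ^ _)]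
    refine Nat.mul_le_mul_left _ (Nat.mul_le_mul_right _ ?_)
    refine Nat.choose_le_choose _ ?_
    have := Nat.mul_le_mul_left k (show E.card ≤ q by omega)
    omega

theorem sum_card_filter_pair (F : Finset (Finset (Finset V))) (hF : F ⊆ hypermatchings k V)
    (c : V) :
    ∑ w ∈ univ.erase c, (F.filter (fun m => ({c, w} : Finset V) ∈ pairs m)).card =
      (k - 1) * F.card := by
  simp only [card_filter]
  rw [sum_comm, sum_congr rfl (g := fun _ => k - 1)]
  · rw [sum_const, smul_eq_mul, mul_comm]
  · intro m hm
    have h := mem_hypermatchings.1 (hF hm)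
    rw [← card_filter, ← h.card_same c, ← card_erase_of_mem (a := c) (by simp [h.same_refl])]
    congr 1
    ext w
    simp only [mem_filter, mem_erase, mem_univ, pair_mem_pairs, ne_eq, and_true, true_and]
    constructor
    · rintro ⟨h1, -, h2⟩
      exact ⟨h1, h2⟩
    · rintro ⟨h1, h2⟩
      exact ⟨h1, Ne.symm h1, h2⟩

theorem smul_pair (σ : Equiv.Perm V) (a b : V) :
    σ • ({a, b} : Finset V) = {σ a, σ b} := by
  simp [smul_finset_def, image_insert]

theorem mem_pairs_smul {σ : Equiv.Perm V} {x : Finset V} {m : Finset (Finset V)} :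
    σ • x ∈ pairs (σ • m) ↔ x ∈ pairs m := by
  rw [pairs_smul, smul_mem_smul_finset_iff]

/-- By symmetry all pairs `{c, w}` through a fixed `c` are equally frequent, and each hypermatching
contains exactly `k - 1` of them. -/
theorem card_filter_mem_pairs {x : Finset V} (hx : x.card = 2) :
    (Fintype.card V - 1) * ((hypermatchings k V).filter (fun m => x ∈ pairs m)).card =
      (k - 1) * (hypermatchings k V).card := by
  obtain ⟨c, d, hcd, rfl⟩ := card_eq_two.1 hx
  rw [← sum_card_filter_pair _ subset_rfl c, sum_congr rfl (g := fun _ =>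
    ((hypermatchings k V).filter (fun m => ({c, d} : Finset V) ∈ pairs m)).card), sum_const,
    card_erase_of_mem (mem_univ _), card_univ, smul_eq_mul]
  intro w hw
  rw [← card_filter_hypermatchings_smul (Equiv.swap d w)]
  congr 1
  refine filter_congr fun m _ => ?_
  rw [← mem_pairs_smul (σ := Equiv.swap d w) (x := {c, d}), smul_pair, Equiv.swap_apply_left,
    Equiv.swap_apply_of_ne_of_ne hcd (ne_of_mem_erase hw).symm]

/-- Choose `d ∈ y` outside `x` and write `y = {c, d}`. Exchanging `d` with any `w` outside `x ∪ {c}`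
fixes `x`, so at least `|V| - 3` pairs `{c, w}` are equally frequent within the star of `x`, and
each member contains at most `k - 1` of them. -/
theorem card_filter_two_pairs_le {x y : Finset V} (hx : x.card = 2) (hy : y.card = 2)
    (hxy : x ≠ y) :
    (Fintype.card V - 3) *
      ((hypermatchings k V).filter (fun m => x ∈ pairs m ∧ y ∈ pairs m)).card ≤
      (k - 1) * ((hypermatchings k V).filter (fun m => x ∈ pairs m)).card := by
  obtain ⟨d, hdy, hdx⟩ : ∃ d ∈ y, d ∉ x := by
    by_contra hcon
    push Not at hcon
    exact hxy (eq_of_subset_of_card_le hcon (by omega)).symm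
  obtain ⟨c, hc⟩ : ∃ c, y.erase d = {c} := card_eq_one.1 (by rw [card_erase_of_mem hdy, hy])
  have hcd : c ≠ d := ne_of_mem_erase (hc ▸ mem_singleton_self c)
  have hyc : y = {c, d} := by rw [← insert_erase hdy, hc, pair_comm]
  subst hyc
  rw [← sum_card_filter_pair _ (filter_subset _ _) c]
  calc (Fintype.card V - 3) * ((hypermatchings k V).filter
        (fun m => x ∈ pairs m ∧ ({c, d} : Finset V) ∈ pairs m)).card
      ≤ ∑ w ∈ univ \ insert c x, ((hypermatchings k V).filter
        (fun m => x ∈ pairs m ∧ ({c, d} : Finset V) ∈ pairs m)).card := by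
        rw [sum_const, smul_eq_mul]
        refine Nat.mul_le_mul_right _ ?_
        have h1 := le_card_sdiff (insert c x) univ
        have h2 := card_insert_le c x
        rw [card_univ] at h1
        omega
    _ = ∑ w ∈ univ \ insert c x, (((hypermatchings k V).filter (fun m => x ∈ pairs m)).filter
          (fun m => ({c, w} : Finset V) ∈ pairs m)).card := by
        refine sum_congr rfl fun w hw => ?_
        simp only [mem_sdiff, mem_univ, true_and, mem_insert, not_or] at hw
        rw [filter_filter, ← card_filter_hypermatchings_smul (Equiv.swap d w)
          (fun m => x ∈ pairs m ∧ ({c, w} : Finset V) ∈ pairs m)]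
        congr 1
        refine filter_congr fun m _ => ?_
        have hσx : Equiv.swap d w • x = x := smul_eq_self_of_forall fun v hv =>
          Equiv.swap_apply_of_ne_of_ne (fun h => hdx (h ▸ hv)) (fun h => hw.2 (h ▸ hv))
        rw [← mem_pairs_smul (σ := Equiv.swap d w) (x := {c, d}),
          ← mem_pairs_smul (σ := Equiv.swap d w) (x := x), hσx, smul_pair, Equiv.swap_apply_left,
          Equiv.swap_apply_of_ne_of_ne hcd (Ne.symm hw.1)]
    _ ≤ _ := by
        refine sum_le_sum_of_subset fun w hw => ?_
        simp only [mem_sdiff, mem_univ, true_and, mem_insert, not_or] at hw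
        exact mem_erase.2 ⟨hw.1, mem_univ _⟩

/-! ### Global families and spread subfamilies -/

/-- The edges of `m` that contain a member of `T`. -/
def hull (T m : Finset (Finset V)) : Finset (Finset V) := m.filter (fun e => ∃ x ∈ T, x ⊆ e)

theorem nonempty_of_mem_pairs {m : Finset (Finset V)} {x : Finset V} (h : x ∈ pairs m) :
    x.Nonempty := by
  obtain ⟨e, -, -, hc⟩ := mem_pairs.1 h
  exact card_pos.1 (by omega)

theorem IsPerfectHypermatching.edge_unique_of_subset {m : Finset (Finset V)}
    (h : IsPerfectHypermatching k m) {e e' x : Finset V} (hx : x.Nonempty) (he : e ∈ m)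
    (he' : e' ∈ m) (hxe : x ⊆ e) (hxe' : x ⊆ e') : e = e' := by
  obtain ⟨v, hv⟩ := hx
  exact h.edge_unique he he' (hxe hv) (hxe' hv)

theorem card_hull_le {T m : Finset (Finset V)} (h : IsPerfectHypermatching k m)
    (hT : T ⊆ pairs m) : (hull T m).card ≤ T.card := by
  have hsub : hull T m ⊆ T.biUnion (fun x => m.filter (fun e => x ⊆ e)) := by
    intro e he
    obtain ⟨hem, x, hx, hxe⟩ := mem_filter.1 he
    exact mem_biUnion.2 ⟨x, hx, mem_filter.2 ⟨hem, hxe⟩⟩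
  refine (card_le_card hsub).trans (card_biUnion_le.trans ?_)
  rw [card_eq_sum_ones]
  refine sum_le_sum fun x hx => card_le_one.2 fun e he e' he' => ?_
  rw [mem_filter] at he he'
  exact h.edge_unique_of_subset (nonempty_of_mem_pairs (hT hx)) he.1 he'.1 he.2 he'.2

/-- This makes the events "`m` contains a given hull of `T`" mutually exclusive for different hulls,
so that their counts add up in `isGlobal_of_spread`. -/
theorem hull_eq_of_subset {T m₀ m : Finset (Finset V)} (h : IsPerfectHypermatching k m)
    (hT : T ⊆ pairs m₀) (hs : hull T m₀ ⊆ m) : hull T m = hull T m₀ := by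
  ext e
  constructor
  · intro he
    obtain ⟨hem, x, hx, hxe⟩ := mem_filter.1 he
    obtain ⟨e', he', hxe', -⟩ := mem_pairs.1 (hT hx)
    have h' : e' ∈ hull T m₀ := mem_filter.2 ⟨he', x, hx, hxe'⟩
    rwa [h.edge_unique_of_subset (nonempty_of_mem_pairs (hT hx)) hem (hs h') hxe hxe']
  · intro he
    exact mem_filter.2 ⟨hs he, (mem_filter.1 he).2⟩

theorem subset_pairs_of_hull_subset {T m₀ m : Finset (Finset V)} (hT : T ⊆ pairs m₀)
    (hs : hull T m₀ ⊆ m) : T ⊆ pairs m := by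
  intro x hx
  obtain ⟨e, he, hxe, hc⟩ := mem_pairs.1 (hT hx)
  exact mem_pairs.2 ⟨e, hs (mem_filter.2 ⟨he, x, hx, hxe⟩), hxe, hc⟩

/-- `F` has almost no more than its share of the hypermatchings through any at most `J` pairs that
avoid `W`. -/
def IsGlobal (k : ℕ) (J : ℕ) (ε : ℝ) (W : Finset V) (F : Finset (Finset (Finset V))) : Prop :=
  ∀ T : Finset (Finset V), T.card ≤ J → (∀ x ∈ T, Disjoint x W) →
    ((F.filter (fun m => T ⊆ pairs m)).card : ℝ) * (hypermatchings k V).card ≤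
      (1 + ε) * F.card * ((hypermatchings k V).filter (fun m => T ⊆ pairs m)).card

/-- Split the members of `F` through the pairs `T` by the hull `E` of `T`, which has at most `J`
edges and avoids `S`. Spreadness costs `R` per edge, while the uniform frequency costs at most the
binomial coefficient, so the ratio is at most `ρ` per edge and `ρ ^ J` in total. -/
theorem isGlobal_of_spread (hk : 0 < k) {F : Finset (Finset (Finset V))}
    (hF : F ⊆ hypermatchings k V) {S : Finset (Finset V)} {J : ℕ} {R ρ ε : ℝ}
    (hspread : ∀ E : Finset (Finset V), Disjoint E S → E.card ≤ J →
      ((F.filter (fun m => E ⊆ m)).card : ℝ) * R ^ E.card ≤ F.card)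
    (hρ : 1 ≤ ρ) (hB : ((Fintype.card V - 1).choose (k - 1) : ℝ) ≤ ρ * R)
    (hε : ρ ^ J ≤ 1 + ε) : IsGlobal k J ε (vertexSet S) F := by
  intro T hTJ hTS
  set FT := F.filter (fun m => T ⊆ pairs m) with hFT
  set ℋ := FT.image (hull T) with hℋ
  have h1 : FT.card ≤ ∑ E ∈ ℋ, (F.filter (fun m => E ⊆ m)).card := by
    rw [card_eq_sum_card_image (hull T) FT]
    refine sum_le_sum fun E _ => card_le_card fun m hm => ?_
    obtain ⟨hm1, rfl⟩ := mem_filter.1 hm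
    exact mem_filter.2 ⟨(mem_filter.1 hm1).1, filter_subset _ _⟩
  have h2 : ∑ E ∈ ℋ, ((hypermatchings k V).filter (fun m => E ⊆ m)).card ≤
      ((hypermatchings k V).filter (fun m => T ⊆ pairs m)).card := by
    rw [← card_biUnion]
    · refine card_le_card fun m hm => ?_
      obtain ⟨E, hE, hm⟩ := mem_biUnion.1 hm
      obtain ⟨m₀, hm₀, rfl⟩ := mem_image.1 hE
      rw [mem_filter] at hm ⊢
      exact ⟨hm.1, subset_pairs_of_hull_subset (mem_filter.1 hm₀).2 hm.2⟩
    · intro E hE E' hE' hne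
      obtain ⟨m₀, hm₀, rfl⟩ := mem_image.1 hE
      obtain ⟨m₁, hm₁, rfl⟩ := mem_image.1 hE'
      refine disjoint_left.2 fun m hm hm' => hne ?_
      rw [mem_filter] at hm hm'
      have h := mem_hypermatchings.1 hm.1
      rw [← hull_eq_of_subset h (mem_filter.1 hm₀).2 hm.2,
        ← hull_eq_of_subset h (mem_filter.1 hm₁).2 hm'.2]
  have h3 : ∀ E ∈ ℋ, ((F.filter (fun m => E ⊆ m)).card : ℝ) * (hypermatchings k V).card ≤
      (1 + ε) * F.card * ((hypermatchings k V).filter (fun m => E ⊆ m)).card := by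
    intro E hE
    obtain ⟨m₀, hm₀, rfl⟩ := mem_image.1 hE
    obtain ⟨hm₀F, hT⟩ := mem_filter.1 hm₀
    have hp := mem_hypermatchings.1 (hF hm₀F)
    have hdisj : Disjoint (hull T m₀) S := by
      refine disjoint_left.2 fun e he heS => ?_
      obtain ⟨-, x, hx, hxe⟩ := mem_filter.1 he
      obtain ⟨v, hv⟩ := nonempty_of_mem_pairs (hT hx)
      exact disjoint_left.1 (hTS x hx) hv (mem_vertexSet.2 ⟨e, heS, hxe hv⟩)
    have hcJ : (hull T m₀).card ≤ J := (card_hull_le hp hT).trans hTJ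
    have hs := hspread _ hdisj hcJ
    have hM : ((hypermatchings k V).card : ℝ) ≤
        ((Fintype.card V - 1).choose (k - 1) : ℝ) ^ (hull T m₀).card *
        ((hypermatchings k V).filter (fun m' => hull T m₀ ⊆ m')).card := by
      exact_mod_cast card_hypermatchings_le hk hp (E := hull T m₀) (filter_subset _ _)
    set N : ℝ := (((hypermatchings k V).filter (fun m' => hull T m₀ ⊆ m')).card : ℝ) with hN
    set c := (hull T m₀).card
    set f : ℝ := ((F.filter (fun m => hull T m₀ ⊆ m)).card : ℝ)
    have hf0 : 0 ≤ f := by positivity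
    have hN0 : 0 ≤ N := by positivity
    calc f * (hypermatchings k V).card
        ≤ f * (((Fintype.card V - 1).choose (k - 1) : ℝ) ^ c * N) := by gcongr
      _ ≤ f * ((ρ * R) ^ c * N) := by gcongr
      _ = (f * R ^ c) * (ρ ^ c * N) := by rw [mul_pow]; ring
      _ ≤ F.card * (ρ ^ J * N) := by gcongr
      _ ≤ F.card * ((1 + ε) * N) := by gcongr
      _ = _ := by ring
  have hε0 : 0 ≤ 1 + ε := le_trans (by positivity) hε
  calc (FT.card : ℝ) * (hypermatchings k V).card
      ≤ (∑ E ∈ ℋ, ((F.filter (fun m => E ⊆ m)).card : ℝ)) * (hypermatchings k V).card := by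
        refine mul_le_mul_of_nonneg_right ?_ (by positivity)
        exact_mod_cast h1
    _ ≤ (1 + ε) * F.card * ∑ E ∈ ℋ, (((hypermatchings k V).filter (fun m => E ⊆ m)).card : ℝ) := by
        rw [sum_mul, mul_sum]
        exact sum_le_sum h3
    _ ≤ _ := by
        refine mul_le_mul_of_nonneg_left ?_ (by positivity)
        exact_mod_cast h2

/-- A family that is not tiny contains a subfamily `{m ∈ F | S ⊆ m}` that is spread. -/
theorem exists_spread_subfamily (hk : 0 < k) {F : Finset (Finset (Finset V))}
    (hF : F ⊆ hypermatchings k V) {q J : ℕ} {δ : ℝ} (hδ : 0 < δ) (hJq : J ≤ q)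
    (hB : 0 < (Fintype.card V - k * q - 1).choose (k - 1))
    (hcard : ((hypermatchings k V).card : ℝ) < F.card * (1 + δ) ^ (q - J)) :
    ∃ S : Finset (Finset V), S.card ≤ q ∧ (F.filter (fun m => S ⊆ m)).Nonempty ∧
      ∀ E : Finset (Finset V), Disjoint E S → E.card ≤ J →
        (((F.filter (fun m => S ⊆ m)).filter (fun m => E ⊆ m)).card : ℝ) *
          (((Fintype.card V - k * q - 1).choose (k - 1) : ℝ) / (1 + δ)) ^ E.card ≤
          (F.filter (fun m => S ⊆ m)).card := by
  set b : ℝ := ((Fintype.card V - k * q - 1).choose (k - 1) : ℝ) with hb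
  have hb0 : 0 < b := by rw [hb]; exact_mod_cast hB
  set R := b / (1 + δ) with hR
  have hR0 : 0 < R := by positivity
  -- Maximise the weight `R ^ |S| * |F_S|`. Comparison with `S ∪ E` is the spread condition,
  -- provided that `S ∪ E` still has at most `q` edges.
  obtain ⟨S, hS, hmax⟩ := exists_max_image
    (univ.filter (fun S : Finset (Finset V) => S.card ≤ q))
    (fun S => R ^ S.card * ((F.filter (fun m => S ⊆ m)).card : ℝ)) ⟨∅, by simp⟩
  have hSq : S.card ≤ q := (mem_filter.1 hS).2
  have h0 := hmax ∅ (by simp)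
  simp only [card_empty, pow_zero, one_mul, empty_subset, filter_true] at h0
  have hFpos : (0 : ℝ) < F.card := by
    by_contra hcon
    have : (F.card : ℝ) = 0 := le_antisymm (not_lt.1 hcon) (by positivity)
    rw [this, zero_mul] at hcard
    exact absurd hcard (not_lt.2 (by positivity))
  have hne : (F.filter (fun m => S ⊆ m)).Nonempty := by
    rw [nonempty_iff_ne_empty]
    intro hemp
    rw [hemp] at h0
    simp at h0
    simp [h0] at hFpos
  obtain ⟨m, hm⟩ := hne
  obtain ⟨hmF, hSm⟩ := mem_filter.1 hm
  -- Comparison with `∅` gives `|F| ≤ R ^ |S| * |F_S|`, while `|F_S|` is at most the number of all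
  -- hypermatchings times `b ^ (-|S|)`. Hence `|F| * (1 + δ) ^ |S|` is at most that number, and a
  -- larger `S` would contradict `hcard`.
  have hSJ : S.card ≤ q - J := by
    by_contra hcon
    push Not at hcon
    have h1 : (((hypermatchings k V).filter (fun m' => S ⊆ m')).card : ℝ) * b ^ S.card ≤
        (hypermatchings k V).card := by
      rw [hb]
      exact_mod_cast card_filter_superset_mul_le hk (mem_hypermatchings.1 (hF hmF)) hSm hSq
    have h2 : ((F.filter (fun m => S ⊆ m)).card : ℝ) ≤
        ((hypermatchings k V).filter (fun m' => S ⊆ m')).card :=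
      Nat.cast_le.2 (card_le_card (filter_subset_filter _ hF))
    have h3 : (F.card : ℝ) * (1 + δ) ^ S.card ≤ (hypermatchings k V).card := by
      calc (F.card : ℝ) * (1 + δ) ^ S.card
          ≤ (R ^ S.card * ((F.filter (fun m => S ⊆ m)).card : ℝ)) * (1 + δ) ^ S.card := by gcongr
        _ = ((F.filter (fun m => S ⊆ m)).card : ℝ) * b ^ S.card := by
            have : b = R * (1 + δ) := by rw [hR]; field_simp
            rw [this, mul_pow]; ring
        _ ≤ ((hypermatchings k V).filter (fun m' => S ⊆ m')).card * b ^ S.card := by gcongr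
        _ ≤ _ := h1
    have h4 : (F.card : ℝ) * (1 + δ) ^ (q - J) ≤ F.card * (1 + δ) ^ S.card := by
      gcongr
      linarith
    linarith
  refine ⟨S, hSq, ⟨m, hm⟩, fun E hES hEJ => ?_⟩
  have h1 := hmax (S ∪ E) (by
    simp only [mem_filter, mem_univ, true_and]
    have := card_union_le S E
    omega)
  rw [card_union_of_disjoint hES.symm, pow_add, mul_assoc] at h1
  have h2 := le_of_mul_le_mul_left h1 (by positivity)
  rw [filter_filter]
  simp only [union_subset_iff] at h2
  linarith

/-! ### Overlap moments: global families with disjoint cores contain disjoint members -/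

/-- Bonferroni's inequality: for `t ≥ 1` the truncated sum is `(-1) ^ J * C(t - 1, J)`, which is
nonpositive for odd `J`. -/
theorem alternating_sum_choose_le {J : ℕ} (hJ : Odd J) (t : ℕ) :
    ∑ j ∈ range (J + 1), (-1 : ℝ) ^ j * (t.choose j : ℝ) ≤ if t = 0 then 1 else 0 := by
  rcases t with _ | t
  · rw [sum_range_succ']
    simp
  · have h : ∑ j ∈ range (J + 1), (-1 : ℝ) ^ j * ((t + 1).choose j : ℝ) =
        (-1) ^ J * t.choose J := by
      exact_mod_cast Int.alternating_sum_range_choose_eq_choose (n := t) (m := J)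
    rw [h, hJ.neg_one_pow, if_neg (Nat.succ_ne_zero t)]
    have : (0 : ℝ) ≤ t.choose J := by positivity
    linarith

/-- The matching lower bound: the error `C(t - 1, J)` is at most `C(t, J + 1)` by Pascal's rule. -/
theorem le_alternating_sum_choose {J : ℕ} (hJ : Odd J) (t : ℕ) :
    (if t = 0 then 1 else 0) - (t.choose (J + 1) : ℝ) ≤
      ∑ j ∈ range (J + 1), (-1 : ℝ) ^ j * (t.choose j : ℝ) := by
  rcases t with _ | t
  · rw [sum_range_succ']
    simp
  · have h : ∑ j ∈ range (J + 1), (-1 : ℝ) ^ j * ((t + 1).choose j : ℝ) =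
        (-1) ^ J * t.choose J := by
      exact_mod_cast Int.alternating_sum_range_choose_eq_choose (n := t) (m := J)
    rw [h, hJ.neg_one_pow, if_neg (Nat.succ_ne_zero t), Nat.choose_succ_succ]
    push_cast
    have : (0 : ℝ) ≤ t.choose (J + 1) := by positivity
    linarith

/-- The proportion of members of `F` that contain all the pairs in `T`. -/
noncomputable def density (F : Finset (Finset (Finset V))) (T : Finset (Finset V)) : ℝ :=
  (F.filter (fun m => T ⊆ pairs m)).card / F.card

/-- The average number of `j`-subsets of the set of pairs in `X` common to a member of `F` and a
member of `G`. -/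
noncomputable def overlapMoment (F G : Finset (Finset (Finset V))) (X : Finset (Finset V))
    (j : ℕ) : ℝ :=
  (∑ m ∈ F, ∑ m' ∈ G, ((X ∩ (pairs m ∩ pairs m')).card.choose j : ℝ)) / (F.card * G.card)

theorem density_nonneg (F : Finset (Finset (Finset V))) (T : Finset (Finset V)) :
    0 ≤ density F T := by
  unfold density
  positivity

/-- Counting `j`-subsets of an overlap by the subset `T` decouples the two families, so moments
become inner products of densities. -/
theorem overlapMoment_eq (F G : Finset (Finset (Finset V))) (X : Finset (Finset V)) (j : ℕ) :
    overlapMoment F G X j = ∑ T ∈ X.powersetCard j, density F T * density G T := by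
  simp only [overlapMoment, density, div_mul_div_comm]
  rw [← sum_div]
  congr 1
  have h : ∀ m m', ((X ∩ (pairs m ∩ pairs m')).card.choose j : ℝ) =
      ∑ T ∈ X.powersetCard j, (if T ⊆ pairs m then 1 else 0) * (if T ⊆ pairs m' then 1 else 0) := by
    intro m m'
    rw [← card_powersetCard, card_eq_sum_ones, Nat.cast_sum]
    simp only [← ite_and, mul_ite, mul_one, mul_zero]
    rw [← sum_filter]
    refine sum_congr ?_ (fun _ _ => by simp)
    ext T
    simp only [mem_powersetCard, mem_filter, subset_inter_iff]
    tauto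
  simp only [h]
  rw [sum_congr rfl (fun m _ => sum_comm), sum_comm]
  refine sum_congr rfl fun T _ => ?_
  rw [← sum_boole, ← sum_boole, sum_mul_sum]

/-- Upper bounds on `a` and `b` alone suffice: the product of deficits `((1 + ε) p - a) ((1 + ε) p -
b)` is nonnegative, and expanding it bounds `∑ a b` from below by sums already known to be near `K`.
-/
theorem sum_mul_close {ι : Type*} {s : Finset ι} {p a b : ι → ℝ} {ε K η : ℝ} (hε : 0 ≤ ε)
    (hε1 : ε ≤ 1) (hη : 0 ≤ η) (hp : ∀ i ∈ s, 0 ≤ p i) (hb : ∀ i ∈ s, 0 ≤ b i)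
    (hap : ∀ i ∈ s, a i ≤ (1 + ε) * p i) (hbp : ∀ i ∈ s, b i ≤ (1 + ε) * p i)
    (hpp : ∑ i ∈ s, p i * p i ≤ K) (hpa : K - η ≤ ∑ i ∈ s, p i * a i)
    (hpb : K - η ≤ ∑ i ∈ s, p i * b i) :
    |∑ i ∈ s, a i * b i - K| ≤ 3 * ε * K + 4 * η := by
  have hK : 0 ≤ K := le_trans (sum_nonneg fun i hi => mul_nonneg (hp i hi) (hp i hi)) hpp
  have hεK : 0 ≤ ε * K := mul_nonneg hε hK
  have hεη : ε * η ≤ η := mul_le_of_le_one_left hη hε1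
  have hεεK : ε * (ε * K) ≤ ε * K := mul_le_of_le_one_left hεK hε1
  have hub : ∑ i ∈ s, a i * b i ≤ (1 + ε) * (1 + ε) * ∑ i ∈ s, p i * p i := by
    rw [mul_sum]
    refine sum_le_sum fun i hi => ?_
    calc a i * b i ≤ ((1 + ε) * p i) * b i := mul_le_mul_of_nonneg_right (hap i hi) (hb i hi)
      _ ≤ ((1 + ε) * p i) * ((1 + ε) * p i) :=
        mul_le_mul_of_nonneg_left (hbp i hi) (mul_nonneg (by linarith) (hp i hi))
      _ = _ := by ring
  have hlb : (1 + ε) * ∑ i ∈ s, p i * b i - (1 + ε) * ((1 + ε) * ∑ i ∈ s, p i * p i -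
      ∑ i ∈ s, p i * a i) ≤ ∑ i ∈ s, a i * b i := by
    simp only [mul_sum, ← sum_sub_distrib]
    refine sum_le_sum fun i hi => ?_
    have h := mul_le_mul_of_nonneg_left (hbp i hi) (sub_nonneg.2 (hap i hi))
    linarith
  have h1 : (1 + ε) * (1 + ε) * ∑ i ∈ s, p i * p i ≤ (1 + ε) * (1 + ε) * K :=
    mul_le_mul_of_nonneg_left hpp (by positivity)
  have h2 : (1 + ε) * (K - η) ≤ (1 + ε) * ∑ i ∈ s, p i * b i :=
    mul_le_mul_of_nonneg_left hpb (by positivity)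
  have h3 : (1 + ε) * ((1 + ε) * ∑ i ∈ s, p i * p i - ∑ i ∈ s, p i * a i) ≤
      (1 + ε) * ((1 + ε) * K - (K - η)) := by
    refine mul_le_mul_of_nonneg_left (sub_le_sub ?_ hpa) (by positivity)
    exact mul_le_mul_of_nonneg_left hpp (by positivity)
  rw [abs_le]
  constructor <;> nlinarith

theorem IsGlobal.density_le {J : ℕ} {ε : ℝ} {W : Finset V} {F : Finset (Finset (Finset V))}
    (h : IsGlobal k J ε W F) (hF : F.Nonempty) (hM : (hypermatchings k V).Nonempty)
    {T : Finset (Finset V)} (hT : T.card ≤ J) (hTW : ∀ x ∈ T, Disjoint x W) :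
    density F T ≤ (1 + ε) * density (hypermatchings k V) T := by
  have h1 : (0 : ℝ) < F.card := by exact_mod_cast hF.card_pos
  have h2 : (0 : ℝ) < (hypermatchings k V).card := by exact_mod_cast hM.card_pos
  unfold density
  rw [← mul_div_assoc, div_le_div_iff₀ h1 h2]
  linarith [h T hT hTW]

/-- The distribution of the overlap with a uniformly random hypermatching does not depend on the
given hypermatching. -/
theorem sum_overlap_eq (hk : 0 < k) {m m₀ : Finset (Finset V)} (hm : m ∈ hypermatchings k V)
    (hm₀ : m₀ ∈ hypermatchings k V) (f : ℕ → ℝ) :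
    ∑ m' ∈ hypermatchings k V, f (pairs m ∩ pairs m').card =
      ∑ m' ∈ hypermatchings k V, f (pairs m₀ ∩ pairs m').card := by
  obtain ⟨σ, rfl⟩ := (mem_hypermatchings.1 hm₀).exists_smul_eq hk (mem_hypermatchings.1 hm)
  rw [← sum_hypermatchings_smul σ]
  refine sum_congr rfl fun m' _ => ?_
  rw [pairs_smul, pairs_smul, ← smul_finset_inter, card_smul_finset]

/-- The proportion of members of a global family that share a pair with a small set of edges is
small. -/
theorem card_filter_not_disjoint_le {J : ℕ} {ε β : ℝ} {F : Finset (Finset (Finset V))}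
    {S S' : Finset (Finset V)} (hF : F ⊆ hypermatchings k V) (hS : ∀ m ∈ F, S ⊆ m)
    (hJ : 1 ≤ J) (hε : 0 ≤ ε) (hβ0 : 0 ≤ β) (h : IsGlobal k J ε (vertexSet S) F) (hFne : F.Nonempty)
    (hdis : Disjoint (pairs S) (pairs S'))
    (hβ : ∀ x : Finset V, x.card = 2 → ((pairs S').card : ℝ) *
      ((hypermatchings k V).filter (fun m => x ∈ pairs m)).card ≤ β * (hypermatchings k V).card) :
    ((F.filter (fun m => ¬ Disjoint (pairs m) (pairs S'))).card : ℝ) ≤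
      (1 + ε) * β * F.card := by
  have hMpos : (0 : ℝ) < (hypermatchings k V).card := by
    exact_mod_cast (hFne.mono hF).card_pos
  rcases (pairs S').eq_empty_or_nonempty with h0 | h0
  · simp only [h0, disjoint_empty_right, not_true_eq_false, filter_false, card_empty, Nat.cast_zero]
    positivity
  have hc0 : (0 : ℝ) < (pairs S').card := by exact_mod_cast h0.card_pos
  have hsub : F.filter (fun m => ¬ Disjoint (pairs m) (pairs S')) ⊆
      (pairs S').biUnion (fun x => F.filter (fun m => x ∈ pairs m)) := by
    intro m hm
    obtain ⟨hmF, hnd⟩ := mem_filter.1 hm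
    obtain ⟨x, h1, h2⟩ := not_disjoint_iff.1 hnd
    exact mem_biUnion.2 ⟨x, h2, mem_filter.2 ⟨hmF, h1⟩⟩
  have hone : ∀ x ∈ pairs S', ((F.filter (fun m => x ∈ pairs m)).card : ℝ) ≤
      (1 + ε) * β * F.card / (pairs S').card := by
    intro x hx
    obtain ⟨e', -, -, hxc⟩ := mem_pairs.1 hx
    have hb := hβ x hxc
    by_cases hxS : Disjoint x (vertexSet S)
    · have h1 := h {x} (by simpa using hJ) (by simpa using hxS)
      simp only [singleton_subset_iff] at h1
      rw [le_div_iff₀ hc0]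
      refine le_of_mul_le_mul_right ?_ hMpos
      calc _ = (((F.filter (fun m => x ∈ pairs m)).card : ℝ) * (hypermatchings k V).card) *
            (pairs S').card := by ring
        _ ≤ ((1 + ε) * F.card * ((hypermatchings k V).filter (fun m => x ∈ pairs m)).card) *
            (pairs S').card := mul_le_mul_of_nonneg_right h1 (by positivity)
        _ = (1 + ε) * F.card * ((pairs S').card *
            ((hypermatchings k V).filter (fun m => x ∈ pairs m)).card) := by ring
        _ ≤ (1 + ε) * F.card * (β * (hypermatchings k V).card) :=
            mul_le_mul_of_nonneg_left hb (by positivity)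
        _ = _ := by ring
    -- A pair touching a vertex of `S` lies in an edge of `S` for every member of `F`, so it would
    -- be a common pair of `S` and `S'`.
    · have : F.filter (fun m => x ∈ pairs m) = ∅ := by
        refine filter_eq_empty_iff.2 fun m hm hxm => ?_
        obtain ⟨v, hvx, hvS⟩ := not_disjoint_iff.1 hxS
        obtain ⟨f, hf, hvf⟩ := mem_vertexSet.1 hvS
        obtain ⟨e, he, hxe, -⟩ := mem_pairs.1 hxm
        have := (mem_hypermatchings.1 (hF hm)).edge_unique he (hS m hm hf) (hxe hvx) hvf
        subst this
        exact disjoint_left.1 hdis (mem_pairs.2 ⟨e, hf, hxe, hxc⟩) hx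
      rw [this, card_empty, Nat.cast_zero]
      positivity
  calc ((F.filter (fun m => ¬ Disjoint (pairs m) (pairs S'))).card : ℝ)
      ≤ ∑ x ∈ pairs S', ((F.filter (fun m => x ∈ pairs m)).card : ℝ) := by
        exact_mod_cast (card_le_card hsub).trans card_biUnion_le
    _ ≤ ∑ x ∈ pairs S', (1 + ε) * β * F.card / (pairs S').card := sum_le_sum hone
    _ = _ := by
        rw [sum_const, nsmul_eq_mul, mul_div_cancel₀ _ hc0.ne']

/-- If all cross pairs of members intersected, the overlap restricted to sets avoiding both cores
could be empty only when a member of one family uses a pair of the other core, which is rare.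
Bonferroni's inequality then makes the alternating sum of overlap moments small, whereas these
moments are close to the uniform ones, whose alternating sum is at least about `p`. -/
theorem exists_disjoint_of_isGlobal (hk : 0 < k) {F₁ F₂ : Finset (Finset (Finset V))}
    (hF₁ : F₁ ⊆ hypermatchings k V) (hF₂ : F₂ ⊆ hypermatchings k V) (hne₁ : F₁.Nonempty)
    (hne₂ : F₂.Nonempty) {S₁ S₂ : Finset (Finset V)} (hS₁ : ∀ m ∈ F₁, S₁ ⊆ m)
    (hS₂ : ∀ m ∈ F₂, S₂ ⊆ m) (hdis : Disjoint (pairs S₁) (pairs S₂)) {J : ℕ}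
    {ε η β p C : ℝ} (hJ : Odd J) (hε : 0 ≤ ε) (hε1 : ε ≤ 1) (hη0 : 0 ≤ η) (hβ0 : 0 ≤ β)
    (hg₁ : IsGlobal k J ε (vertexSet S₁) F₁) (hg₂ : IsGlobal k J ε (vertexSet S₂) F₂)
    (hp : ∀ m ∈ hypermatchings k V, p * (hypermatchings k V).card ≤
      ((hypermatchings k V).filter (fun m' => Disjoint (pairs m) (pairs m'))).card)
    (hC : ∀ m ∈ hypermatchings k V, ∑ m' ∈ hypermatchings k V,
      (4 : ℝ) ^ (pairs m ∩ pairs m').card ≤ C * (hypermatchings k V).card)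
    (hη : ∀ m ∈ hypermatchings k V, ∀ j ≤ J, ∑ m' ∈ hypermatchings k V,
      (((pairs m ∩ pairs m').card.choose j : ℝ) -
        ((univ.filter (fun x => Disjoint x (vertexSet S₁ ∪ vertexSet S₂)) ∩
          (pairs m ∩ pairs m')).card.choose j : ℝ)) ≤ η * (hypermatchings k V).card)
    (hβ₁ : ∀ x : Finset V, x.card = 2 → ((pairs S₁).card : ℝ) *
      ((hypermatchings k V).filter (fun m => x ∈ pairs m)).card ≤ β * (hypermatchings k V).card)
    (hβ₂ : ∀ x : Finset V, x.card = 2 → ((pairs S₂).card : ℝ) *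
      ((hypermatchings k V).filter (fun m => x ∈ pairs m)).card ≤ β * (hypermatchings k V).card)
    (hfin : C / 3 ^ (J + 1) + 3 * ε * C + 4 * (J + 1) * η + 2 * ((1 + ε) * β) < p) :
    ∃ m₁ ∈ F₁, ∃ m₂ ∈ F₂, Disjoint (pairs m₁) (pairs m₂) := by
  by_contra! hcon
  obtain ⟨m₀, hm₀⟩ := hne₁.mono hF₁
  set M := hypermatchings k V with hM
  have hMne : M.Nonempty := ⟨m₀, hm₀⟩
  have hMpos : (0 : ℝ) < M.card := by exact_mod_cast hMne.card_pos
  have hpos₁ : (0 : ℝ) < F₁.card := by exact_mod_cast hne₁.card_pos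
  have hpos₂ : (0 : ℝ) < F₂.card := by exact_mod_cast hne₂.card_pos
  set X : Finset (Finset V) := univ.filter (fun x => Disjoint x (vertexSet S₁ ∪ vertexSet S₂))
    with hX
  set K : ℕ → ℝ := fun j => (∑ m' ∈ M, ((pairs m₀ ∩ pairs m').card.choose j : ℝ)) / M.card with hK
  have hKm : ∀ m ∈ M, ∀ j, ∑ m' ∈ M, ((pairs m ∩ pairs m').card.choose j : ℝ) = M.card * K j := by
    intro m hm j
    rw [hK]
    dsimp only
    rw [mul_div_cancel₀ _ hMpos.ne']
    exact sum_overlap_eq hk hm hm₀ (fun t => (t.choose j : ℝ))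
  -- moments against the uniform distribution
  have hMM : ∀ j, overlapMoment M M univ j = K j := by
    intro j
    simp only [overlapMoment, univ_inter]
    rw [sum_congr rfl (fun m hm => hKm m hm j), sum_const, nsmul_eq_mul]
    field_simp
  -- Against a uniform hypermatching, every fixed member has the same unrestricted moments `K j` by
  -- transitivity; restricting to sets that avoid the cores costs at most `η`.
  have hMF : ∀ F ⊆ M, F.Nonempty → ∀ j ≤ J, K j - η ≤
      ∑ T ∈ X.powersetCard j, density M T * density F T := by
    intro F hF hFne j hj
    have hpos : (0 : ℝ) < F.card := by exact_mod_cast hFne.card_pos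
    rw [← overlapMoment_eq, overlapMoment, sum_comm, le_div_iff₀ (mul_pos hMpos hpos)]
    have h1 : ∀ m ∈ F, M.card * (K j - η) ≤
        ∑ m' ∈ M, ((X ∩ (pairs m' ∩ pairs m)).card.choose j : ℝ) := by
      intro m hm
      have h2 := hη m (hF hm) j hj
      rw [sum_sub_distrib, hKm m (hF hm) j] at h2
      simp only [fun m' => inter_comm (pairs m') (pairs m)]
      linarith
    calc (K j - η) * (M.card * F.card) = ∑ m ∈ F, M.card * (K j - η) := by
          rw [sum_const, nsmul_eq_mul]; ring
      _ ≤ _ := sum_le_sum h1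
  have hclose : ∀ j ≤ J, |overlapMoment F₁ F₂ X j - K j| ≤ 3 * ε * K j + 4 * η := by
    intro j hj
    rw [overlapMoment_eq]
    have hTX : ∀ T ∈ X.powersetCard j, T.card ≤ J ∧ (∀ x ∈ T, Disjoint x (vertexSet S₁)) ∧
        (∀ x ∈ T, Disjoint x (vertexSet S₂)) := by
      intro T hT
      obtain ⟨h1, h2⟩ := mem_powersetCard.1 hT
      refine ⟨h2 ▸ hj, fun x hx => ?_, fun x hx => ?_⟩
      · exact (disjoint_union_right.1 (mem_filter.1 (h1 hx)).2).1
      · exact (disjoint_union_right.1 (mem_filter.1 (h1 hx)).2).2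
    refine sum_mul_close (p := density M) hε hε1 hη0 (fun T _ => density_nonneg _ _)
      (fun T _ => density_nonneg _ _) (fun T hT => ?_) (fun T hT => ?_) ?_
      (hMF F₁ hF₁ hne₁ j hj) (hMF F₂ hF₂ hne₂ j hj)
    · exact hg₁.density_le hne₁ hMne (hTX T hT).1 (hTX T hT).2.1
    · exact hg₂.density_le hne₂ hMne (hTX T hT).1 (hTX T hT).2.2
    · rw [← hMM j, overlapMoment_eq]
      exact sum_le_sum_of_subset_of_nonneg (powersetCard_mono (subset_univ X))
        (fun T _ _ => mul_nonneg (density_nonneg _ _) (density_nonneg _ _))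
  -- the moments of the uniform distribution
  have hKsum : ∑ j ∈ range (J + 1), K j ≤ C := by
    rw [hK, ← sum_div, div_le_iff₀ hMpos, sum_comm]
    refine le_trans (sum_le_sum fun m' _ => ?_) (hC m₀ hm₀)
    set t := (pairs m₀ ∩ pairs m').card
    calc ∑ j ∈ range (J + 1), (t.choose j : ℝ) ≤ 2 ^ t := by
          have h1 : ∑ j ∈ range (J + 1), t.choose j ≤ 2 ^ t := by
            rw [← Nat.sum_range_choose]
            rcases le_total J t with hJt | hJt
            · exact sum_le_sum_of_subset (range_mono (by omega))
            · refine le_of_eq (sum_subset (range_mono (by omega)) ?_).symm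
              intro j _ hj
              exact Nat.choose_eq_zero_of_lt (by simpa using hj)
          exact_mod_cast h1
      _ ≤ 4 ^ t := by gcongr; norm_num
  have hKlast : K (J + 1) ≤ C / 3 ^ (J + 1) := by
    rw [hK]
    dsimp only
    rw [div_le_div_iff₀ hMpos (by positivity), sum_mul]
    refine le_trans (sum_le_sum fun m' _ => ?_) (hC m₀ hm₀)
    set t := (pairs m₀ ∩ pairs m').card
    -- Binomial expansion of `(3 + 1) ^ t`, whose term of index `J + 1` gives the tail bound `C / 3
    -- ^ (J + 1)`.
    have h1 : (4 : ℝ) ^ t = ∑ j ∈ range (t + 1), 3 ^ j * (t.choose j : ℝ) := by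
      have := add_pow (3 : ℝ) 1 t
      simp only [one_pow, mul_one] at this
      rw [← this]; norm_num
    rw [h1]
    by_cases hjt : J + 1 ≤ t
    · rw [mul_comm]
      exact single_le_sum (f := fun j => (3 : ℝ) ^ j * (t.choose j : ℝ))
        (fun j _ => by positivity) (mem_range.2 (by omega))
    · rw [Nat.choose_eq_zero_of_lt (by omega), Nat.cast_zero, zero_mul]
      exact sum_nonneg fun j _ => by positivity
  have hKalt : p - K (J + 1) ≤ ∑ j ∈ range (J + 1), (-1 : ℝ) ^ j * K j := by
    have h1 : ∑ j ∈ range (J + 1), (-1 : ℝ) ^ j * K j = (∑ m' ∈ M, ∑ j ∈ range (J + 1),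
        (-1 : ℝ) ^ j * ((pairs m₀ ∩ pairs m').card.choose j : ℝ)) / M.card := by
      rw [sum_comm, sum_div]
      refine sum_congr rfl fun j _ => ?_
      rw [← mul_sum, mul_div_assoc]
    rw [h1, le_div_iff₀ hMpos, sub_mul, mul_comm (K _), ← hKm m₀ hm₀]
    refine le_trans (sub_le_sub_right (hp m₀ hm₀) _) ?_
    rw [← sum_boole, ← sum_sub_distrib]
    refine sum_le_sum fun m' _ => ?_
    refine le_trans (le_of_eq ?_) (le_alternating_sum_choose hJ _)
    simp only [disjoint_iff_inter_eq_empty, card_eq_zero]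
  -- upper bound for the alternating sum
  have hup : ∑ j ∈ range (J + 1), (-1 : ℝ) ^ j * overlapMoment F₁ F₂ X j ≤
      2 * ((1 + ε) * β) := by
    have h1 : ∑ j ∈ range (J + 1), (-1 : ℝ) ^ j * overlapMoment F₁ F₂ X j =
        (∑ m ∈ F₁, ∑ m' ∈ F₂, ∑ j ∈ range (J + 1),
          (-1 : ℝ) ^ j * ((X ∩ (pairs m ∩ pairs m')).card.choose j : ℝ)) /
          (F₁.card * F₂.card) := by
      rw [sum_congr rfl (fun m _ => sum_comm), sum_comm, sum_div]
      refine sum_congr rfl fun j _ => ?_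
      simp only [overlapMoment, ← mul_sum, mul_div_assoc]
    have h2 : ∀ m ∈ F₁, ∀ m' ∈ F₂, ∑ j ∈ range (J + 1),
          (-1 : ℝ) ^ j * ((X ∩ (pairs m ∩ pairs m')).card.choose j : ℝ) ≤
        (if ¬ Disjoint (pairs m) (pairs S₂) then 1 else 0) +
        (if ¬ Disjoint (pairs m') (pairs S₁) then 1 else 0) := by
      intro m hm m' hm'
      refine (alternating_sum_choose_le hJ _).trans ?_
      split_ifs with h0 h3 h4 h4 <;> norm_num
      obtain ⟨x, hx, hx'⟩ := not_disjoint_iff.1 (hcon m hm m' hm')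
      have hxX : x ∉ X := by
        intro hxX
        rw [card_eq_zero] at h0
        exact notMem_empty x (h0 ▸ mem_inter.2 ⟨hxX, mem_inter.2 ⟨hx, hx'⟩⟩)
      -- A common pair outside `X` touches a core, hence is a pair of that core, and the member of
      -- the other family contains it.
      have hmeet : ∀ m ∈ M, ∀ S ⊆ m, x ∈ pairs m → ¬ Disjoint x (vertexSet S) → x ∈ pairs S := by
        intro m hm S hS hxm hxS
        obtain ⟨v, hvx, hvS⟩ := not_disjoint_iff.1 hxS
        obtain ⟨f, hf, hvf⟩ := mem_vertexSet.1 hvS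
        obtain ⟨e, he, hxe, hxc⟩ := mem_pairs.1 hxm
        have := (mem_hypermatchings.1 hm).edge_unique he (hS hf) (hxe hvx) hvf
        subst this
        exact mem_pairs.2 ⟨e, hf, hxe, hxc⟩
      rw [hX, mem_filter, disjoint_union_right] at hxX
      simp only [mem_univ, true_and, not_and_or] at hxX
      rcases hxX with h5 | h5
      · exact disjoint_left.1 h4 hx' (hmeet m (hF₁ hm) S₁ (hS₁ m hm) hx h5)
      · exact disjoint_left.1 h3 hx (hmeet m' (hF₂ hm') S₂ (hS₂ m' hm') hx' h5)
    have hb₁ := card_filter_not_disjoint_le hF₁ hS₁ hJ.pos hε hβ0 hg₁ hne₁ hdis hβ₂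
    have hb₂ := card_filter_not_disjoint_le hF₂ hS₂ hJ.pos hε hβ0 hg₂ hne₂ hdis.symm hβ₁
    rw [h1, div_le_iff₀ (mul_pos hpos₁ hpos₂)]
    refine (sum_le_sum fun m hm => sum_le_sum fun m' hm' => h2 m hm m' hm').trans ?_
    simp only [sum_add_distrib, sum_const, nsmul_eq_mul, ← mul_sum, sum_boole]
    calc _ ≤ (F₂.card : ℝ) * ((1 + ε) * β * F₁.card) + F₁.card * ((1 + ε) * β * F₂.card) :=
          add_le_add (mul_le_mul_of_nonneg_left hb₁ hpos₂.le)
            (mul_le_mul_of_nonneg_left hb₂ hpos₁.le)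
      _ = _ := by ring
  have hlow : ∑ j ∈ range (J + 1), (-1 : ℝ) ^ j * K j - (3 * ε * C + 4 * (J + 1) * η) ≤
      ∑ j ∈ range (J + 1), (-1 : ℝ) ^ j * overlapMoment F₁ F₂ X j := by
    have h1 : ∀ j ∈ range (J + 1), (-1 : ℝ) ^ j * K j - (3 * ε * K j + 4 * η) ≤
        (-1 : ℝ) ^ j * overlapMoment F₁ F₂ X j := by
      intro j hj
      have h2 := abs_le.1 (hclose j (Nat.lt_succ_iff.1 (mem_range.1 hj)))
      rcases neg_one_pow_eq_or ℝ j with h3 | h3 <;> rw [h3] <;> linarith [h2.1, h2.2]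
    refine le_trans ?_ (sum_le_sum h1)
    rw [sum_sub_distrib, sum_add_distrib, ← mul_sum, sum_const, card_range, nsmul_eq_mul]
    push_cast
    have h4 : 3 * ε * ∑ j ∈ range (J + 1), K j ≤ 3 * ε * C :=
      mul_le_mul_of_nonneg_left hKsum (by positivity)
    linarith
  linarith

/-! ### Estimates for a uniform hypermatching -/

theorem card_pairs_inter_le {m m' : Finset (Finset V)} (h : IsPerfectHypermatching k m) :
    (pairs m ∩ pairs m').card ≤ k * (badVertices m m' ∅).card := by
  have hsub : pairs m ∩ pairs m' ⊆ (badVertices m m' ∅).biUnion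
      (fun v => (univ.filter (fun u => SameEdge m v u)).image (fun u => ({v, u} : Finset V))) := by
    intro x hx
    obtain ⟨h1, h2⟩ := mem_inter.1 hx
    obtain ⟨-, -, -, hc⟩ := mem_pairs.1 h1
    obtain ⟨u, v, -, rfl⟩ := card_eq_two.1 hc
    obtain ⟨hne, h1⟩ := pair_mem_pairs.1 h1
    refine mem_biUnion.2 ⟨u, mem_badVertices.2 ⟨notMem_empty _, v, hne.symm, h1,
      (pair_mem_pairs.1 h2).2⟩, mem_image.2 ⟨v, by simpa using h1, rfl⟩⟩
  refine (card_le_card hsub).trans (card_biUnion_le.trans ?_)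
  refine (sum_le_sum (g := fun _ => k) fun v _ => ?_).trans ?_
  · exact card_image_le.trans (h.card_same v).le
  · rw [sum_const, smul_eq_mul, mul_comm]

theorem card_pairs_not_disjoint_le {m : Finset (Finset V)} (h : IsPerfectHypermatching k m)
    (W : Finset V) : ((pairs m).filter (fun x => ¬ Disjoint x W)).card ≤ k * W.card := by
  have hsub : (pairs m).filter (fun x => ¬ Disjoint x W) ⊆ W.biUnion
      (fun v => (univ.filter (fun u => SameEdge m v u)).image (fun u => ({v, u} : Finset V))) := by
    intro x hx
    obtain ⟨h1, h2⟩ := mem_filter.1 hx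
    obtain ⟨v, hvx, hvW⟩ := not_disjoint_iff.1 h2
    obtain ⟨e, he, hxe, hc⟩ := mem_pairs.1 h1
    obtain ⟨u, hu⟩ := card_eq_one.1 (show (x.erase v).card = 1 by rw [card_erase_of_mem hvx, hc])
    have hxu : x = {v, u} := by rw [← insert_erase hvx, hu]
    refine mem_biUnion.2 ⟨v, hvW, mem_image.2 ⟨u, ?_, hxu.symm⟩⟩
    rw [hxu] at h1
    simpa using (pair_mem_pairs.1 h1).2
  refine (card_le_card hsub).trans (card_biUnion_le.trans ?_)
  refine (sum_le_sum (g := fun _ => k) fun v _ => ?_).trans ?_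
  · exact card_image_le.trans (h.card_same v).le
  · rw [sum_const, smul_eq_mul, mul_comm]

theorem card_pairs_le {m S : Finset (Finset V)} (h : IsPerfectHypermatching k m) (hS : S ⊆ m) :
    (pairs S).card ≤ k ^ 2 * S.card := by
  refine card_biUnion_le.trans ((sum_le_sum (g := fun _ => k ^ 2) fun e he => ?_).trans ?_)
  · rw [card_powersetCard, h.1 e (hS he)]
    exact Nat.choose_le_pow k 2
  · rw [sum_const, smul_eq_mul, mul_comm]

/-- The overlap is at most `k` times the number of bad vertices, hence the base `z = 4 ^ k`. -/
theorem sum_four_pow_le {m : Finset (Finset V)} (h : IsPerfectHypermatching k m)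
    (hV : 4 * (k * k) ≤ Fintype.card V) :
    ∑ m' ∈ hypermatchings k V, (4 : ℝ) ^ (pairs m ∩ pairs m').card ≤
      2 * ((4 ^ k : ℕ) : ℝ) ^ (4 * (k * k) * (4 ^ k) ^ (2 * k)) * (hypermatchings k V).card := by
  refine le_trans (sum_le_sum fun m' _ => ?_)
    (sum_pow_badVertices_le h hV (z := 4 ^ k) (Nat.one_le_pow _ _ (by norm_num)))
  push_cast
  rw [← pow_mul]
  exact pow_le_pow_right₀ (by norm_num) (card_pairs_inter_le h)

theorem card_le_card_disjoint {m : Finset (Finset V)} (h : IsPerfectHypermatching k m)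
    (hV : 4 * (k * k) ≤ Fintype.card V) :
    ((hypermatchings k V).card : ℝ) ≤ 2 * (1 + 2 * (k * k)) ^ (4 * (k * k)) *
      ((hypermatchings k V).filter (fun m' => Disjoint (pairs m) (pairs m'))).card := by
  refine (card_le_card_badVertices_eq_zero (A := ∅) h subset_rfl
    (fun m' hm' v w _ _ => smul_mem_hypermatchings.2 hm') (by simp; omega)).trans ?_
  refine mul_le_mul_of_nonneg_left (Nat.cast_le.2 (card_le_card fun m' hm' => ?_)) (by positivity)
  obtain ⟨h1, h2⟩ := mem_filter.1 hm'
  refine mem_filter.2 ⟨h1, disjoint_pairs_iff.2 fun u v huv hu hv => ?_⟩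
  exact notMem_empty u (h2 ▸ mem_badVertices.2 ⟨notMem_empty _, v, huv.symm, hu, hv⟩)

/-- Switching with `A = x` stays inside the star of `x`. With no bad vertex outside `x`, the only
possible common pair is `x` itself, which `m` does not contain. -/
theorem card_star_le_card_disjoint {m : Finset (Finset V)} (h : IsPerfectHypermatching k m)
    {x : Finset V} (hx : x.card = 2) (hxm : x ∉ pairs m)
    (hV : 4 * (k * k) + 4 ≤ Fintype.card V) :
    (((hypermatchings k V).filter (fun m' => x ∈ pairs m')).card : ℝ) ≤
      2 * (1 + 2 * (k * k)) ^ (4 * (k * k)) *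
      (((hypermatchings k V).filter (fun m' => x ∈ pairs m')).filter
        (fun m' => Disjoint (pairs m) (pairs m'))).card := by
  refine (card_le_card_badVertices_eq_zero (A := x) h (filter_subset _ _)
    (fun m' hm' v w hv hw => ?_) (by omega)).trans ?_
  · rw [mem_filter] at hm' ⊢
    refine ⟨smul_mem_hypermatchings.2 hm'.1, ?_⟩
    have hσx : Equiv.swap v w • x = x := smul_eq_self_of_forall fun u hu =>
      Equiv.swap_apply_of_ne_of_ne (fun h => hv (h ▸ hu)) (fun h => hw (h ▸ hu))
    rw [← hσx, mem_pairs_smul]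
    exact hm'.2
  refine mul_le_mul_of_nonneg_left (Nat.cast_le.2 (card_le_card fun m' hm' => ?_)) (by positivity)
  obtain ⟨h1, h2⟩ := mem_filter.1 hm'
  refine mem_filter.2 ⟨h1, disjoint_pairs_iff.2 fun u v huv hu hv => ?_⟩
  by_cases hux : u ∈ x
  · by_cases hvx : v ∈ x
    · have : ({u, v} : Finset V) = x := eq_of_subset_of_card_le
        (by simp [insert_subset_iff, hux, hvx]) (by rw [hx, card_pair huv])
      exact hxm (this ▸ pair_mem_pairs.2 ⟨huv, hu⟩)
    · exact notMem_empty v (h2 ▸ mem_badVertices.2 ⟨hvx, u, huv, hu.symm, hv.symm⟩)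
  · exact notMem_empty u (h2 ▸ mem_badVertices.2 ⟨hux, v, huv.symm, hu, hv⟩)

theorem mul_card_star_le (hk : 2 ≤ k) {n : ℕ} (hV : Fintype.card V = k * n) {x : Finset V}
    (hx : x.card = 2) :
    n * ((hypermatchings k V).filter (fun m => x ∈ pairs m)).card ≤ (hypermatchings k V).card := by
  have h := card_filter_mem_pairs (k := k) hx
  have h1 : (k - 1) * n ≤ k * n - 1 := by
    have := card_le_univ x
    rw [hx, hV] at this
    rcases Nat.eq_zero_or_pos n with h0 | h0
    · simp [h0] at this
    · rw [Nat.sub_mul, one_mul]; omega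
  refine Nat.le_of_mul_le_mul_left ?_ (show 0 < k - 1 by omega)
  rw [← h, hV, ← mul_assoc]
  exact Nat.mul_le_mul_right _ h1

theorem card_le_mul_card_star (hk : 2 ≤ k) {x : Finset V} (hx : x.card = 2) :
    (hypermatchings k V).card ≤
      Fintype.card V * ((hypermatchings k V).filter (fun m => x ∈ pairs m)).card := by
  have h := card_filter_mem_pairs (k := k) hx
  calc _ ≤ (k - 1) * (hypermatchings k V).card := Nat.le_mul_of_pos_left _ (by omega)
    _ = _ := h.symm
    _ ≤ _ := Nat.mul_le_mul_right _ (by omega)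

theorem mul_card_two_pairs_le (hk : 2 ≤ k) {n : ℕ} (hV : Fintype.card V = k * n) (hn : 3 ≤ n)
    {x y : Finset V} (hx : x.card = 2) (hy : y.card = 2) (hxy : x ≠ y) :
    n * ((hypermatchings k V).filter (fun m => x ∈ pairs m ∧ y ∈ pairs m)).card ≤
      ((hypermatchings k V).filter (fun m => x ∈ pairs m)).card := by
  have h := card_filter_two_pairs_le (k := k) hx hy hxy
  have h1 : (k - 1) * n ≤ k * n - 3 := by
    rw [Nat.sub_mul, one_mul]; omega
  refine Nat.le_of_mul_le_mul_left ?_ (show 0 < k - 1 by omega)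
  refine le_trans ?_ h
  rw [hV, ← mul_assoc]
  exact Nat.mul_le_mul_right _ h1

/-- The restriction matters only when `m'` contains one of the at most `k * |W|` pairs of `m` that
touch `W`, each of probability at most `1 / n`. On that event the binomial is at most `2 ^ t ≤ A + 4
^ t / A`: the cutoff `A` trades the event's small probability against the exponential moment. -/
theorem sum_choose_sub_le (hk : 2 ≤ k) {n : ℕ} (hV : Fintype.card V = k * n) (hn : 0 < n)
    {m : Finset (Finset V)} (h : IsPerfectHypermatching k m) (W : Finset V) (j : ℕ) {A C : ℝ}
    (hA : 0 < A) (hC : ∑ m' ∈ hypermatchings k V, (4 : ℝ) ^ (pairs m ∩ pairs m').card ≤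
      C * (hypermatchings k V).card) :
    ∑ m' ∈ hypermatchings k V, (((pairs m ∩ pairs m').card.choose j : ℝ) -
      ((univ.filter (fun x => Disjoint x W) ∩ (pairs m ∩ pairs m')).card.choose j : ℝ)) ≤
      (A * (k * W.card / n) + C / A) * (hypermatchings k V).card := by
  set M := hypermatchings k V
  set X : Finset (Finset V) := univ.filter (fun x => Disjoint x W) with hX
  set Y := (pairs m).filter (fun x => ¬ Disjoint x W)
  have hn' : (0 : ℝ) < n := by exact_mod_cast hn
  have hpt : ∀ m' ∈ M, ((pairs m ∩ pairs m').card.choose j : ℝ) -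
      ((X ∩ (pairs m ∩ pairs m')).card.choose j : ℝ) ≤
      A * (if ¬ Disjoint Y (pairs m') then 1 else 0) +
        (4 : ℝ) ^ (pairs m ∩ pairs m').card / A := by
    intro m' _
    set t := (pairs m ∩ pairs m').card with ht
    have h4 : (0 : ℝ) ≤ (4 : ℝ) ^ t / A := by positivity
    by_cases hd : Disjoint Y (pairs m')
    · have : X ∩ (pairs m ∩ pairs m') = pairs m ∩ pairs m' := by
        refine inter_eq_right.2 fun x hx => ?_
        rw [mem_inter] at hx
        by_contra hxX
        refine disjoint_left.1 hd (mem_filter.2 ⟨hx.1, fun hdx => hxX ?_⟩) hx.2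
        exact mem_filter.2 ⟨mem_univ _, hdx⟩
      rw [this, ← ht, sub_self, if_neg (not_not.2 hd)]
      linarith
    · rw [if_pos hd, mul_one]
      have h1 : (t.choose j : ℝ) ≤ 2 ^ t := by exact_mod_cast Nat.choose_le_two_pow t j
      have h2 : (0 : ℝ) ≤ ((X ∩ (pairs m ∩ pairs m')).card.choose j : ℝ) := Nat.cast_nonneg _
      have h3 : (2 : ℝ) ^ t ≤ A + 4 ^ t / A := by
        rcases le_total ((2 : ℝ) ^ t) A with h5 | h5
        · linarith
        · have h6 : (2 : ℝ) ^ t ≤ 4 ^ t / A := by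
            rw [le_div_iff₀ hA, show (4 : ℝ) = 2 * 2 by norm_num, mul_pow]
            exact mul_le_mul_of_nonneg_left h5 (by positivity)
          linarith
      linarith
  have hB : ((M.filter (fun m' => ¬ Disjoint Y (pairs m'))).card : ℝ) ≤
      k * W.card / n * M.card := by
    have hsub : M.filter (fun m' => ¬ Disjoint Y (pairs m')) ⊆
        Y.biUnion (fun x => M.filter (fun m' => x ∈ pairs m')) := by
      intro m' hm'
      obtain ⟨h1, h2⟩ := mem_filter.1 hm'
      obtain ⟨x, hxY, hx⟩ := not_disjoint_iff.1 h2
      exact mem_biUnion.2 ⟨x, hxY, mem_filter.2 ⟨h1, hx⟩⟩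
    have h1 : n * (M.filter (fun m' => ¬ Disjoint Y (pairs m'))).card ≤ k * W.card * M.card := by
      calc _ ≤ n * ∑ x ∈ Y, (M.filter (fun m' => x ∈ pairs m')).card :=
            Nat.mul_le_mul_left _ ((card_le_card hsub).trans card_biUnion_le)
        _ ≤ ∑ x ∈ Y, M.card := by
            rw [mul_sum]
            refine sum_le_sum fun x hx => mul_card_star_le hk hV ?_
            obtain ⟨-, -, -, hc⟩ := mem_pairs.1 (mem_filter.1 hx).1
            exact hc
        _ = Y.card * M.card := by rw [sum_const, smul_eq_mul]
        _ ≤ _ := Nat.mul_le_mul_right _ (card_pairs_not_disjoint_le h W)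
    rw [div_mul_eq_mul_div, le_div_iff₀ hn', mul_comm]
    exact_mod_cast h1
  refine (sum_le_sum hpt).trans ?_
  rw [sum_add_distrib, ← mul_sum, ← sum_div, sum_boole, add_mul, mul_assoc]
  exact add_le_add (mul_le_mul_of_nonneg_left hB hA.le)
    ((div_le_div_of_nonneg_right hC hA.le).trans_eq (by ring))

/-! ### Choice of parameters -/

theorem exists_pow_le (N : ℕ) {ε : ℝ} (hε : 0 < ε) : ∃ δ : ℝ, 0 < δ ∧ (1 + δ) ^ N ≤ 1 + ε := by
  have hcont : Filter.Tendsto (fun δ : ℝ => (1 + δ) ^ N) (nhdsWithin 0 (Set.Ioi 0)) (nhds 1) := by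
    have : Filter.Tendsto (fun δ : ℝ => (1 + δ) ^ N) (nhds 0) (nhds ((1 + 0) ^ N)) :=
      (Continuous.tendsto (by fun_prop) 0)
    simp only [add_zero, one_pow] at this
    exact this.mono_left nhdsWithin_le_nhds
  have h1 := hcont.eventually (eventually_le_nhds (show (1 : ℝ) < 1 + ε by linarith))
  obtain ⟨δ, h2, h3⟩ := (h1.and self_mem_nhdsWithin).exists
  exact ⟨δ, h3, h2⟩

/-- The constants are chosen in the order `J`, `ε`, `δ`, `A`, `θ`, so that each of the five error
terms is at most `p / 8`. The product `2 * θ` bounds the share of pairs touching two cores, and `A *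
(2 * θ) + C / A` is the loss `η`. -/
theorem exists_parameters {C p : ℝ} (hC : 0 < C) (hp : 0 < p) :
    ∃ (J : ℕ) (ε δ A θ : ℝ), Odd J ∧ 0 ≤ ε ∧ ε ≤ 1 ∧ 0 < δ ∧ 0 < A ∧ 0 < θ ∧
      ((1 + δ) ^ 2) ^ J ≤ 1 + ε ∧
      C / 3 ^ (J + 1) + 3 * ε * C + 4 * (J + 1) * (A * (2 * θ) + C / A) +
        2 * ((1 + ε) * θ) < p := by
  obtain ⟨i, hi⟩ := exists_pow_lt_of_lt_one (show 0 < p / (8 * C) by positivity)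
    (show (1 / 3 : ℝ) < 1 by norm_num)
  set J := 2 * i + 1 with hJ
  have hJ1 : C / 3 ^ (J + 1) ≤ p / 8 := by
    have h1 : (1 / 3 : ℝ) ^ (J + 1) ≤ (1 / 3) ^ i :=
      pow_le_pow_of_le_one (by norm_num) (by norm_num) (by omega)
    rw [div_eq_mul_one_div, ← one_div_pow]
    calc C * (1 / 3) ^ (J + 1) ≤ C * (p / (8 * C)) :=
          mul_le_mul_of_nonneg_left (h1.trans hi.le) hC.le
      _ = p / 8 := by field_simp
  set ε := min 1 (p / (24 * C)) with hε
  have hε0 : 0 < ε := lt_min one_pos (by positivity)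
  have hε1 : ε ≤ 1 := min_le_left _ _
  have hε2 : 3 * ε * C ≤ p / 8 := by
    calc 3 * ε * C ≤ 3 * (p / (24 * C)) * C := by
          gcongr
          exact min_le_right _ _
      _ = p / 8 := by field_simp; norm_num
  obtain ⟨δ, hδ0, hδ⟩ := exists_pow_le (2 * J) hε0
  set A : ℝ := 32 * (J + 1) * C / p with hA
  have hA0 : 0 < A := by positivity
  have hA1 : 4 * (J + 1) * (C / A) = p / 8 := by
    rw [hA]; field_simp; norm_num
  set θ : ℝ := min (p / 32) (p / (64 * (J + 1) * A)) with hθ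
  have hθ0 : 0 < θ := lt_min (by positivity) (by positivity)
  have hθ1 : θ ≤ p / 32 := min_le_left _ _
  have hθ2 : 4 * (J + 1) * (A * (2 * θ)) ≤ p / 8 := by
    calc 4 * (J + 1) * (A * (2 * θ)) ≤ 4 * (J + 1) * (A * (2 * (p / (64 * (J + 1) * A)))) := by
          gcongr
          exact min_le_right _ _
      _ = p / 8 := by field_simp; norm_num
  have hθ3 : 2 * ((1 + ε) * θ) ≤ p / 8 := by
    have : (1 + ε) * θ ≤ 2 * (p / 32) :=
      mul_le_mul (by linarith) hθ1 hθ0.le (by norm_num)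
    linarith
  refine ⟨J, ε, δ, A, θ, ⟨i, hJ⟩, hε0.le, hε1, hδ0, hA0, hθ0, ?_, ?_⟩
  · rw [← pow_mul]
    exact hδ
  · linarith

/-- A size that is at most of order `√n`, but whose exponential dominates `n`. -/
theorem exists_size (c J : ℕ) (hc : 1 ≤ c) {δ : ℝ} (hδ : 0 < δ) (L : ℝ) (hL : 0 < L) :
    ∃ n₀ : ℕ, ∀ n : ℕ, n₀ ≤ n → ∃ q : ℕ, J ≤ q ∧ 1 ≤ q ∧ c * q ^ 2 ≤ n ∧
      L * n ≤ (1 + δ) ^ (q - J) := by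
  have ht := tendsto_pow_const_div_const_pow_of_one_lt 2 (show (1 : ℝ) < 1 + δ by linarith)
  obtain ⟨i₀, hi₀⟩ := Filter.eventually_atTop.1 (ht.eventually
    (eventually_le_nhds (show (0 : ℝ) < 1 / (L * c * (J + 2) ^ 2) by positivity)))
  set Q := J + i₀ + 1 with hQ
  refine ⟨c * Q ^ 2, fun n hn => ?_⟩
  set q := Nat.sqrt (n / c) with hq
  have hQq : Q ≤ q := by
    rw [hq, Nat.le_sqrt', Nat.le_div_iff_mul_le (by omega), mul_comm]
    exact hn
  have hcq : c * q ^ 2 ≤ n := by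
    have h1 : q ^ 2 ≤ n / c := Nat.sqrt_le' _
    rw [Nat.le_div_iff_mul_le (by omega)] at h1
    linarith
  have hnq : n ≤ c * (q + 1) ^ 2 := by
    have h1 : n / c < (q + 1) ^ 2 := Nat.lt_succ_sqrt' _
    rw [Nat.div_lt_iff_lt_mul (by omega)] at h1
    linarith
  refine ⟨q, by omega, by omega, hcq, ?_⟩
  obtain ⟨i, hi⟩ : ∃ i, q = J + i := ⟨q - J, by omega⟩
  have hi1 : 1 ≤ i := by omega
  have h2 := hi₀ i (by omega)
  rw [hi, Nat.add_sub_cancel_left]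
  have hpow : (0 : ℝ) < (1 + δ) ^ i := by positivity
  rw [div_le_iff₀ hpow, div_mul_eq_mul_div, le_div_iff₀ (by positivity), one_mul] at h2
  refine le_trans ?_ h2
  -- With `q = J + i` and `i ≥ 1`, this reduces the quadratic bound on `n` to `i ^ 2`, which the
  -- exponential in `i` dominates.
  have h3 : (q : ℝ) + 1 ≤ (J + 2) * i := by
    have : q + 1 ≤ (J + 2) * i := by nlinarith
    exact_mod_cast this
  calc L * n ≤ L * (c * ((q : ℝ) + 1) ^ 2) := by
        refine mul_le_mul_of_nonneg_left ?_ hL.le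
        exact_mod_cast hnq
    _ ≤ L * (c * (((J : ℝ) + 2) * i) ^ 2) := by gcongr
    _ = _ := by ring

/-- Compares the largest and smallest factors met when up to `q` edges are prescribed: up to `(k -
1)!` they lie between `(k (n - q - 1)) ^ (k - 1)` and `(k n) ^ (k - 1)`. -/
theorem choose_le_mul_choose {n q : ℕ} {γ δ : ℝ} (hk : 1 ≤ k) (hγ : 0 ≤ γ)
    (hγδ : (1 + γ) ^ (k - 1) ≤ 1 + δ) (hq : q + 1 ≤ n)
    (hnq : (n : ℝ) ≤ (1 + γ) * (n - q - 1)) :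
    ((k * n - 1).choose (k - 1) : ℝ) ≤ (1 + δ) * (k * n - k * q - 1).choose (k - 1) := by
  have hkq : k * (q + 1) ≤ k * n := Nat.mul_le_mul_left k hq
  have h1 : ((k * n - 1).descFactorial (k - 1) : ℝ) ≤ ((k : ℝ) * n) ^ (k - 1) := by
    have := Nat.descFactorial_le_pow (k * n - 1) (k - 1)
    have h2 : (k * n - 1) ^ (k - 1) ≤ (k * n) ^ (k - 1) := Nat.pow_le_pow_left (by omega) _
    exact_mod_cast this.trans h2
  have h2 : ((k : ℝ) * (n - q - 1)) ^ (k - 1) ≤ (k * n - k * q - 1).descFactorial (k - 1) := by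
    have h3 := Nat.pow_sub_le_descFactorial (k * n - k * q - 1) (k - 1)
    have h4 : k * (n - q - 1) ≤ k * n - k * q - 1 + 1 - (k - 1) := by
      rw [Nat.mul_sub, Nat.mul_sub]
      rw [Nat.mul_add] at hkq
      omega
    have h5 := (Nat.pow_le_pow_left h4 (k - 1)).trans h3
    have h6 : ((n - q - 1 : ℕ) : ℝ) = (n : ℝ) - q - 1 := by
      rw [Nat.cast_sub (by omega), Nat.cast_sub (by omega), Nat.cast_one]
    rw [← h6]
    exact_mod_cast h5
  have hfac : (0 : ℝ) < (k - 1).factorial := by exact_mod_cast Nat.factorial_pos _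
  rw [Nat.descFactorial_eq_factorial_mul_choose] at h1 h2
  push_cast at h1 h2
  have hx : (0 : ℝ) ≤ (n : ℝ) - q - 1 := by
    have : ((q + 1 : ℕ) : ℝ) ≤ n := Nat.cast_le.2 hq
    push_cast at this
    linarith
  refine le_of_mul_le_mul_left ?_ hfac
  calc _ ≤ ((k : ℝ) * n) ^ (k - 1) := h1
    _ ≤ ((1 + γ) * ((k : ℝ) * (n - q - 1))) ^ (k - 1) := by
        refine pow_le_pow_left₀ (by positivity) ?_ _
        have := mul_le_mul_of_nonneg_left hnq (Nat.cast_nonneg (α := ℝ) k)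
        linarith
    _ = (1 + γ) ^ (k - 1) * ((k : ℝ) * (n - q - 1)) ^ (k - 1) := mul_pow _ _ _
    _ ≤ (1 + δ) * ((k - 1).factorial * (k * n - k * q - 1).choose (k - 1)) :=
        mul_le_mul hγδ h2 (by positivity) (le_trans (by positivity) hγδ)
    _ = _ := by ring

end

/-! ### Cores of large subfamilies -/

/-- In a large intersecting family, every subfamily that is not tiny has a small core, and any two
of these cores meet in a pair. -/
theorem exists_cores {k : ℕ} (hk : 2 ≤ k) {L : ℝ} (hL : 0 < L) :
    ∃ n₀ : ℕ, ∀ n : ℕ, n₀ ≤ n → ∀ (V : Type) [DecidableEq V] [Fintype V],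
      Fintype.card V = k * n → ∀ F ⊆ hypermatchings k V,
      (∀ m ∈ F, ∀ m' ∈ F, ¬ Disjoint (pairs m) (pairs m')) →
      ∃ (q : ℕ) (S : Finset (Finset (Finset V)) → Finset (Finset V)),
        4 * k ^ 4 * q ^ 2 ≤ n ∧
        (∀ G ⊆ F, ((hypermatchings k V).card : ℝ) < G.card * (L * n) →
          (S G).card ≤ q ∧ ∃ m ∈ G, S G ⊆ m) ∧
        ∀ G ⊆ F, ((hypermatchings k V).card : ℝ) < G.card * (L * n) →
          ∀ G' ⊆ F, ((hypermatchings k V).card : ℝ) < G'.card * (L * n) →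
            ¬ Disjoint (pairs (S G)) (pairs (S G')) := by
  set C : ℝ := 2 * ((4 ^ k : ℕ) : ℝ) ^ (4 * (k * k) * (4 ^ k) ^ (2 * k)) with hC
  have hC0 : 0 < C := by rw [hC]; positivity
  set P : ℝ := 2 * (1 + 2 * (k * k)) ^ (4 * (k * k)) with hP
  have hP0 : 0 < P := by rw [hP]; positivity
  clear_value C P
  obtain ⟨J, ε, δ, A, θ, hJ, hε0, hε1, hδ, hA, hθ, hδJ, hfin⟩ :=
    exists_parameters hC0 (show 0 < 1 / P by positivity)
  obtain ⟨γ, hγ0, hγ⟩ := exists_pow_le (k - 1) hδ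
  -- The three summands serve the final bound `4 k⁴ q² ≤ n`, the rarity bound `k² q ≤ θ n`, and the
  -- comparison `n ≤ (1 + γ) (n - q - 1)`.
  obtain ⟨c, hc⟩ := exists_nat_ge (4 * (k : ℝ) ^ 4 + k ^ 2 / θ + 2 * (1 + γ) / γ)
  have hkpos : (0 : ℝ) < k := by exact_mod_cast (by omega : 0 < k)
  have hc1 : 4 * (k : ℝ) ^ 4 ≤ c := by
    have h1 : 0 ≤ (k : ℝ) ^ 2 / θ := by positivity
    have h2 : 0 ≤ 2 * (1 + γ) / γ := by positivity
    linarith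
  have hc2 : (k : ℝ) ^ 2 ≤ θ * c := by
    have h1 : 0 ≤ 4 * (k : ℝ) ^ 4 := by positivity
    have h2 : 0 ≤ 2 * (1 + γ) / γ := by positivity
    rw [mul_comm, ← div_le_iff₀ hθ]
    linarith
  have hc3 : 2 * (1 + γ) ≤ γ * c := by
    have h1 : 0 ≤ 4 * (k : ℝ) ^ 4 := by positivity
    have h2 : 0 ≤ (k : ℝ) ^ 2 / θ := by positivity
    rw [mul_comm γ, ← div_le_iff₀ hγ0]
    linarith
  have hc1' : 4 * k ^ 4 ≤ c := by exact_mod_cast hc1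
  have hc4 : 4 ≤ c := by
    have : 1 ≤ k ^ 4 := Nat.one_le_pow _ _ (by omega)
    omega
  obtain ⟨n₀, hn₀⟩ := exists_size c J (by omega) hδ L hL
  refine ⟨max n₀ (4 * k), fun n hn V _ _ hV F hF hint => ?_⟩
  obtain ⟨q, hJq, hq1, hcq, hq⟩ := hn₀ n ((le_max_left _ _).trans hn)
  have hn4 : 4 * k ≤ n := (le_max_right _ _).trans hn
  have hcq' : c * q ≤ n := le_trans (Nat.mul_le_mul_left _ (by nlinarith)) hcq
  have hcqR : (c : ℝ) * q ≤ n := by exact_mod_cast hcq'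
  have hq1R : (1 : ℝ) ≤ q := by exact_mod_cast hq1
  have hnpos : (0 : ℝ) < n := by exact_mod_cast (by omega : 0 < n)
  have hqn : q + 1 ≤ n := by nlinarith
  have hVk : 4 * (k * k) ≤ Fintype.card V := by
    rw [hV]; nlinarith
  have hθq : (k : ℝ) ^ 2 * q ≤ θ * n := by
    calc (k : ℝ) ^ 2 * q ≤ θ * c * q := by gcongr
      _ = θ * (c * q) := by ring
      _ ≤ θ * n := by gcongr
  have hB := choose_le_mul_choose (k := k) (n := n) (q := q) (by omega) hγ0.le hγ hqn (by
    have h1 : 2 * (1 + γ) * q ≤ γ * n := by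
      calc 2 * (1 + γ) * q ≤ γ * c * q := by gcongr
        _ = γ * (c * q) := by ring
        _ ≤ γ * n := by gcongr
    have h2 : (1 + γ) * 1 ≤ (1 + γ) * q := by gcongr
    linarith)
  have hB0 : 0 < (Fintype.card V - k * q - 1).choose (k - 1) := by
    have h1 : 0 < (k * n - 1).choose (k - 1) := Nat.choose_pos (by
      have := Nat.mul_le_mul_left k (show 1 ≤ n by omega)
      omega)
    rw [hV]
    by_contra hcon
    rw [Nat.eq_zero_of_not_pos hcon, Nat.cast_zero, mul_zero] at hB
    exact absurd hB (not_le.2 (by exact_mod_cast h1))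
  set M := hypermatchings k V with hM
  have hext : ∀ G : Finset (Finset (Finset V)), G ⊆ F → (M.card : ℝ) < G.card * (L * n) →
      ∃ S : Finset (Finset V), S.card ≤ q ∧ (G.filter (fun m => S ⊆ m)).Nonempty ∧
        IsGlobal k J ε (vertexSet S) (G.filter (fun m => S ⊆ m)) := by
    intro G hG hlarge
    obtain ⟨S, hSq, hne, hsp⟩ := exists_spread_subfamily (k := k) (by omega) (hG.trans hF) hδ hJq
      hB0 (hlarge.trans_le (mul_le_mul_of_nonneg_left hq (Nat.cast_nonneg _)))
    -- One factor `1 + δ` of `ρ` comes from the spread parameter `b / (1 + δ)`, the other from the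
    -- comparison of binomial coefficients.
    refine ⟨S, hSq, hne, isGlobal_of_spread (k := k) (by omega)
      ((filter_subset _ _).trans (hG.trans hF)) hsp (ρ := (1 + δ) ^ 2)
      (one_le_pow₀ (by linarith)) ?_ hδJ⟩
    rw [hV]
    refine hB.trans (le_of_eq ?_)
    field_simp
  choose! S hSq hSne hSg using hext
  refine ⟨q, S, le_trans (Nat.mul_le_mul_right _ hc1') hcq, fun G hG hl => ⟨hSq G hG hl, ?_⟩, ?_⟩
  · obtain ⟨m, hm⟩ := hSne G hG hl
    exact ⟨m, (mem_filter.1 hm).1, (mem_filter.1 hm).2⟩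
  intro G hG hl G' hG' hl' hdis
  have hsub : ∀ G ⊆ F, (M.card : ℝ) < G.card * (L * n) → ∃ m ∈ M, S G ⊆ m := by
    intro G hG hl
    obtain ⟨m, hm⟩ := hSne G hG hl
    exact ⟨m, hF (hG (mem_filter.1 hm).1), (mem_filter.1 hm).2⟩
  have hβ : ∀ G ⊆ F, (M.card : ℝ) < G.card * (L * n) → ∀ x : Finset V, x.card = 2 →
      ((pairs (S G)).card : ℝ) * (M.filter (fun m => x ∈ pairs m)).card ≤ θ * M.card := by
    intro G hG hl x hx
    obtain ⟨m, hm, hSm⟩ := hsub G hG hl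
    have h1 : ((pairs (S G)).card : ℝ) ≤ θ * n := by
      refine le_trans ?_ hθq
      have h2 := card_pairs_le (mem_hypermatchings.1 hm) hSm
      have h3 := h2.trans (Nat.mul_le_mul_left _ (hSq G hG hl))
      exact_mod_cast h3
    have h2 : (n : ℝ) * (M.filter (fun m => x ∈ pairs m)).card ≤ M.card := by
      exact_mod_cast mul_card_star_le hk hV hx
    calc _ ≤ θ * n * (M.filter (fun m => x ∈ pairs m)).card :=
          mul_le_mul_of_nonneg_right h1 (Nat.cast_nonneg _)
      _ = θ * (n * (M.filter (fun m => x ∈ pairs m)).card) := by ring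
      _ ≤ _ := mul_le_mul_of_nonneg_left h2 hθ.le
  have hCm : ∀ m ∈ M, ∑ m' ∈ M, (4 : ℝ) ^ (pairs m ∩ pairs m').card ≤ C * M.card := by
    intro m hm
    rw [hC]
    exact sum_four_pow_le (mem_hypermatchings.1 hm) hVk
  have hpm : ∀ m ∈ M, 1 / P * M.card ≤
      (M.filter (fun m' => Disjoint (pairs m) (pairs m'))).card := by
    intro m hm
    rw [one_div_mul_eq_div, div_le_iff₀ hP0, mul_comm, hP]
    exact card_le_card_disjoint (mem_hypermatchings.1 hm) hVk
  have hηm : ∀ m ∈ M, ∀ j ≤ J, ∑ m' ∈ M, (((pairs m ∩ pairs m').card.choose j : ℝ) -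
      ((univ.filter (fun x => Disjoint x (vertexSet (S G) ∪ vertexSet (S G'))) ∩
        (pairs m ∩ pairs m')).card.choose j : ℝ)) ≤ (A * (2 * θ) + C / A) * M.card := by
    intro m hm j _
    refine (sum_choose_sub_le hk hV (by omega) (mem_hypermatchings.1 hm) _ j hA (hCm m hm)).trans ?_
    refine mul_le_mul_of_nonneg_right (add_le_add (mul_le_mul_of_nonneg_left ?_ hA.le) le_rfl)
      (Nat.cast_nonneg _)
    rw [div_le_iff₀ hnpos]
    have hW : ∀ G ⊆ F, (M.card : ℝ) < G.card * (L * n) → (vertexSet (S G)).card ≤ k * q := by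
      intro G hG hl
      obtain ⟨m, hm, hSm⟩ := hsub G hG hl
      rw [(mem_hypermatchings.1 hm).card_vertexSet hSm]
      exact Nat.mul_le_mul_left _ (hSq G hG hl)
    have h1 : (vertexSet (S G) ∪ vertexSet (S G')).card ≤ 2 * (k * q) := by
      have h2 := card_union_le (vertexSet (S G)) (vertexSet (S G'))
      have h3 := hW G hG hl
      have h4 := hW G' hG' hl'
      omega
    have h2 : ((vertexSet (S G) ∪ vertexSet (S G')).card : ℝ) ≤ 2 * (k * q) := by exact_mod_cast h1
    calc (k : ℝ) * (vertexSet (S G) ∪ vertexSet (S G')).card ≤ k * (2 * (k * q)) := by gcongr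
      _ = 2 * (k ^ 2 * q) := by ring
      _ ≤ 2 * (θ * n) := by gcongr
      _ = _ := by ring
  obtain ⟨m₁, hm₁, m₂, hm₂, hd⟩ := exists_disjoint_of_isGlobal (k := k) (by omega)
    ((filter_subset _ _).trans (hG.trans hF)) ((filter_subset _ _).trans (hG'.trans hF))
    (hSne G hG hl) (hSne G' hG' hl') (fun m hm => (mem_filter.1 hm).2)
    (fun m hm => (mem_filter.1 hm).2) hdis hJ hε0 hε1 (η := A * (2 * θ) + C / A)
    (by positivity) hθ.le (hSg G hG hl) (hSg G' hG' hl') (p := 1 / P) hpm hCm hηm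
    (hβ G hG hl) (hβ G' hG' hl') hfin
  exact hint m₁ (hG (mem_filter.1 hm₁).1) m₂ (hG' (mem_filter.1 hm₂).1) hd

/-! ### From cores to a star -/

/-- A largest intersecting family consists of all the hypermatchings through a fixed pair. -/
theorem exists_eq_star {k : ℕ} (hk : 2 ≤ k) :
    ∃ n₀ : ℕ, ∀ n : ℕ, n₀ ≤ n → ∀ (V : Type) [DecidableEq V] [Fintype V],
      Fintype.card V = k * n → ∀ F ⊆ hypermatchings k V,
      (∀ m ∈ F, ∀ m' ∈ F, ¬ Disjoint (pairs m) (pairs m')) →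
      (∀ x : Finset V, x.card = 2 →
        ((hypermatchings k V).filter (fun m => x ∈ pairs m)).card ≤ F.card) →
      ∃ x : Finset V, x.card = 2 ∧ F = (hypermatchings k V).filter (fun m => x ∈ pairs m) := by
  set P : ℝ := 2 * (1 + 2 * (k * k)) ^ (4 * (k * k)) with hP
  have hP1 : 1 ≤ P := by
    have : (1 : ℝ) ≤ (1 + 2 * (k * k)) ^ (4 * (k * k)) := one_le_pow₀ (by
      have : (0 : ℝ) ≤ 2 * (k * k) := by positivity
      linarith)
    rw [hP]; linarith
  have hP0 : 0 < P := by linarith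
  clear_value P
  have hkpos : (0 : ℝ) < k := by exact_mod_cast (by omega : 0 < k)
  -- With `L = 4 P k`, a family that is not large satisfies `P * |G| ≤ s / 4`, because all
  -- hypermatchings number at most `k n s`.
  obtain ⟨n₀, hn₀⟩ := exists_cores hk (L := 4 * P * k) (by positivity)
  refine ⟨max n₀ (4 * k + 4), fun n hn V _ _ hV F hF hint hmax => ?_⟩
  obtain ⟨q, S, hq, hS, hSS⟩ := hn₀ n ((le_max_left _ _).trans hn) V hV F hF hint
  have hn4 : 4 * k + 4 ≤ n := (le_max_right _ _).trans hn
  have hnpos : (0 : ℝ) < n := by exact_mod_cast (by omega : 0 < n)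
  have hVk : 4 * (k * k) + 4 ≤ Fintype.card V := by
    rw [hV]; nlinarith
  set M := hypermatchings k V with hM
  set star : Finset V → Finset (Finset (Finset V)) := fun x => M.filter (fun m => x ∈ pairs m)
    with hstar
  obtain ⟨x₀, -, hx₀⟩ := exists_subset_card_eq (s := (univ : Finset V)) (n := 2) (by
    rw [card_univ]; omega)
  rcases M.eq_empty_or_nonempty with hM0 | hMne
  · refine ⟨x₀, hx₀, ?_⟩
    rw [hM0] at hF ⊢
    rw [subset_empty.1 hF, filter_empty]
  have hMpos : (0 : ℝ) < M.card := by exact_mod_cast hMne.card_pos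
  -- all stars have the same size
  set s : ℝ := ((star x₀).card : ℝ) with hs
  have hstar_card : ∀ x : Finset V, x.card = 2 → ((star x).card : ℝ) = s := by
    intro x hx
    rw [hs]
    congr 1
    refine Nat.eq_of_mul_eq_mul_left (show 0 < Fintype.card V - 1 by omega) ?_
    exact (card_filter_mem_pairs hx).trans (card_filter_mem_pairs hx₀).symm
  have hMs : (M.card : ℝ) ≤ k * n * s := by
    have := card_le_mul_card_star hk hx₀
    rw [hV] at this
    rw [hs]
    exact_mod_cast this
  have hs0 : 0 < s := by
    by_contra hcon
    have : (k : ℝ) * n * s ≤ 0 := mul_nonpos_of_nonneg_of_nonpos (by positivity) (not_lt.1 hcon)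
    linarith
  have hFs : s ≤ F.card := Nat.cast_le.2 (hmax x₀ hx₀)
  -- families that are not large are tiny
  have hsmall : ∀ G : Finset (Finset (Finset V)), ¬ ((M.card : ℝ) < G.card * (4 * P * k * n)) →
      P * G.card ≤ s / 4 := by
    intro G hG
    have h1 := (not_lt.1 hG).trans hMs
    have h2 : (k * n : ℝ) * (4 * (P * G.card)) ≤ k * n * s := by linarith
    have := le_of_mul_le_mul_left h2 (by positivity)
    linarith
  have hsmall' : ∀ G : Finset (Finset (Finset V)), ¬ ((M.card : ℝ) < G.card * (4 * P * k * n)) →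
      (G.card : ℝ) ≤ s / 4 := by
    intro G hG
    refine le_trans ?_ (hsmall G hG)
    exact le_mul_of_one_le_left (Nat.cast_nonneg _) hP1
  have hFlarge : (M.card : ℝ) < F.card * (4 * P * k * n) := by
    by_contra hcon
    have := hsmall' F hcon
    linarith
  set G : Finset V → Finset (Finset (Finset V)) := fun x => F.filter (fun m => x ∉ pairs m) with hG
  have hGF : ∀ x, G x ⊆ F := fun x => filter_subset _ _
  -- some star contains almost all of the family
  have hx : ∃ x : Finset V, x.card = 2 ∧ ¬ ((M.card : ℝ) < (G x).card * (4 * P * k * n)) := by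
    by_contra! hcon
    have hpair : ∀ {H : Finset (Finset (Finset V))}, ∀ x ∈ pairs (S H), x.card = 2 := by
      intro H x hx
      obtain ⟨-, -, -, hc⟩ := mem_pairs.1 hx
      exact hc
    -- The remainder that no choice of two pairs covers. If it were large, its core would share a
    -- pair `x` with the core of `F` and a pair `y` with the core of `G x`; a member of `H`
    -- containing that core would then contain both pairs, which `H` forbids.
    set H := F.filter (fun m => ∀ x ∈ pairs (S F), ∀ y ∈ pairs (S (G x)),
      ¬ (x ∈ pairs m ∧ y ∈ pairs m)) with hH
    have hHF : H ⊆ F := filter_subset _ _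
    have hHsmall : ¬ ((M.card : ℝ) < H.card * (4 * P * k * n)) := by
      intro hl
      obtain ⟨x, hxF, hxH⟩ := not_disjoint_iff.1 (hSS F subset_rfl hFlarge H hHF hl)
      obtain ⟨y, hyG, hyH⟩ := not_disjoint_iff.1
        (hSS (G x) (hGF x) (hcon x (hpair x hxF)) H hHF hl)
      obtain ⟨-, m, hm, hSm⟩ := hS H hHF hl
      exact (mem_filter.1 hm).2 x hxF y hyG ⟨pairs_mono hSm hxH, pairs_mono hSm hyH⟩
    have hcov : F ⊆ H ∪ (pairs (S F)).biUnion (fun x => (pairs (S (G x))).biUnion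
        (fun y => M.filter (fun m => x ∈ pairs m ∧ y ∈ pairs m))) := by
      intro m hm
      by_cases hmH : m ∈ H
      · exact mem_union_left _ hmH
      · simp only [hH, mem_filter, hm, true_and] at hmH
        push Not at hmH
        obtain ⟨x, hx, y, hy, h1, h2⟩ := hmH
        exact mem_union_right _ (mem_biUnion.2 ⟨x, hx, mem_biUnion.2 ⟨y, hy,
          mem_filter.2 ⟨hF hm, h1, h2⟩⟩⟩)
    have hSc : ∀ H ⊆ F, (M.card : ℝ) < H.card * (4 * P * k * n) →
        (pairs (S H)).card ≤ k ^ 2 * q := by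
      intro H hH hl
      obtain ⟨hc, m, hm, hSm⟩ := hS H hH hl
      exact (card_pairs_le (mem_hypermatchings.1 (hF (hH hm))) hSm).trans
        (Nat.mul_le_mul_left _ hc)
    have htwo : ∀ x ∈ pairs (S F), ∀ y ∈ pairs (S (G x)),
        ((M.filter (fun m => x ∈ pairs m ∧ y ∈ pairs m)).card : ℝ) ≤ s / n := by
      intro x hx y hy
      -- The core of `G x` lies in a member that avoids `x`, so its pairs differ from `x`.
      have hxy : x ≠ y := by
        rintro rfl
        obtain ⟨-, m, hm, hSm⟩ := hS (G x) (hGF x) (hcon x (hpair x hx))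
        exact (mem_filter.1 hm).2 (pairs_mono hSm hy)
      have h1 := mul_card_two_pairs_le hk hV (by omega) (hpair x hx) (hpair y hy) hxy
      rw [le_div_iff₀ hnpos, ← hstar_card x (hpair x hx), mul_comm]
      exact_mod_cast h1
    have hcount : (F.card : ℝ) ≤ H.card + ((k ^ 2 * q : ℕ) : ℝ) * (((k ^ 2 * q : ℕ) : ℝ) * (s / n)) := by
      have h1 := (card_le_card hcov).trans (card_union_le _ _)
      have h2 : (((pairs (S F)).biUnion (fun x => (pairs (S (G x))).biUnion
          (fun y => M.filter (fun m => x ∈ pairs m ∧ y ∈ pairs m)))).card : ℝ) ≤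
          ((k ^ 2 * q : ℕ) : ℝ) * (((k ^ 2 * q : ℕ) : ℝ) * (s / n)) := by
        have h3 : ∀ x ∈ pairs (S F), (((pairs (S (G x))).biUnion
            (fun y => M.filter (fun m => x ∈ pairs m ∧ y ∈ pairs m))).card : ℝ) ≤
            ((k ^ 2 * q : ℕ) : ℝ) * (s / n) := by
          intro x hx
          calc _ ≤ ∑ y ∈ pairs (S (G x)),
                ((M.filter (fun m => x ∈ pairs m ∧ y ∈ pairs m)).card : ℝ) := by
                exact_mod_cast card_biUnion_le
            _ ≤ ∑ y ∈ pairs (S (G x)), s / n := sum_le_sum (htwo x hx)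
            _ = (pairs (S (G x))).card * (s / n) := by rw [sum_const, nsmul_eq_mul]
            _ ≤ _ := mul_le_mul_of_nonneg_right
              (Nat.cast_le.2 (hSc (G x) (hGF x) (hcon x (hpair x hx)))) (by positivity)
        calc _ ≤ ∑ x ∈ pairs (S F), (((pairs (S (G x))).biUnion
                (fun y => M.filter (fun m => x ∈ pairs m ∧ y ∈ pairs m))).card : ℝ) := by
              exact_mod_cast card_biUnion_le
          _ ≤ ∑ x ∈ pairs (S F), ((k ^ 2 * q : ℕ) : ℝ) * (s / n) := sum_le_sum h3
          _ = (pairs (S F)).card * (((k ^ 2 * q : ℕ) : ℝ) * (s / n)) := by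
              rw [sum_const, nsmul_eq_mul]
          _ ≤ _ := mul_le_mul_of_nonneg_right (Nat.cast_le.2 (hSc F subset_rfl hFlarge))
              (by positivity)
      calc (F.card : ℝ) ≤ (H.card : ℝ) + (((pairs (S F)).biUnion (fun x =>
            (pairs (S (G x))).biUnion
            (fun y => M.filter (fun m => x ∈ pairs m ∧ y ∈ pairs m)))).card : ℝ) := by
            exact_mod_cast h1
        _ ≤ _ := by linarith
    have hq' : ((k ^ 2 * q : ℕ) : ℝ) * (((k ^ 2 * q : ℕ) : ℝ) * (s / n)) ≤ s / 4 := by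
      have h1 : 4 * ((k ^ 2 * q : ℕ) : ℝ) ^ 2 ≤ n := by
        have : 4 * (k ^ 2 * q) ^ 2 ≤ n := by
          refine le_trans (le_of_eq ?_) hq
          ring
        exact_mod_cast this
      calc _ = (4 * ((k ^ 2 * q : ℕ) : ℝ) ^ 2) * (s / n) / 4 := by ring
        _ ≤ n * (s / n) / 4 := by gcongr
        _ = s / 4 := by field_simp
    have := hsmall' H hHsmall
    linarith
  obtain ⟨x, hx2, hx⟩ := hx
  -- From stability to equality: a member `m` avoiding `x` excludes from `F` the set `D` of star
  -- members disjoint from it, with `s ≤ P * |D|`. As `|F| ≥ s`, this loss forces `|D| ≤ |G x|`,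
  -- contradicting `P * |G x| ≤ s / 4`.
  have hFx : ∀ m ∈ F, x ∈ pairs m := by
    intro m hm
    by_contra hxm
    have h1 := card_star_le_card_disjoint (mem_hypermatchings.1 (hF hm)) hx2 hxm hVk
    rw [← hP] at h1
    set D := (star x).filter (fun m' => Disjoint (pairs m) (pairs m')) with hD
    have h2 : s ≤ P * D.card := by
      rw [← hstar_card x hx2]
      exact h1
    have hcov : F ⊆ G x ∪ (star x \ D) := by
      intro m' hm'
      by_cases hxm' : x ∈ pairs m'
      · refine mem_union_right _ (mem_sdiff.2 ⟨mem_filter.2 ⟨hF hm', hxm'⟩, fun hmD => ?_⟩)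
        exact hint m hm m' hm' (mem_filter.1 hmD).2
      · exact mem_union_left _ (mem_filter.2 ⟨hm', hxm'⟩)
    have h3 : (F.card : ℝ) ≤ (G x).card + (s - D.card) := by
      have h4 := (card_le_card hcov).trans (card_union_le _ _)
      have h5 := card_sdiff_add_card_eq_card (filter_subset _ _ : D ⊆ star x)
      have h6 : ((star x \ D).card : ℝ) + D.card = s := by
        rw [← hstar_card x hx2]
        exact_mod_cast h5
      have h7 : (F.card : ℝ) ≤ (G x).card + (star x \ D).card := by exact_mod_cast h4
      linarith
    have h4 := hsmall (G x) hx
    have h5 : (D.card : ℝ) ≤ (G x).card := by linarith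
    have h6 := mul_le_mul_of_nonneg_left h5 hP0.le
    linarith
  refine ⟨x, hx2, eq_of_subset_of_card_le (fun m hm => mem_filter.2 ⟨hF hm, hFx m hm⟩) (hmax x hx2)⟩

/-! ### The theorem on `Fin (k * n)` -/

theorem mainTheorem1 (k : ℕ) (hk : 2 ≤ k) :
    ∃ n₀ : ℕ, ∀ n : ℕ, n₀ ≤ n →
      ∀ F : Finset (Finset (Finset (Fin (k * n)))),
        IsLargestPartially2IntersectingFamily k n F →
          ∃ i j : Fin (k * n), i ≠ j ∧ F = canonicalFamily k n i j := by
  obtain ⟨n₀, hn₀⟩ := exists_eq_star hk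
  refine ⟨n₀, fun n hn F hF => ?_⟩
  obtain ⟨⟨hsub, hint⟩, hmax⟩ := hF
  have hM : perfectHypermatchings k n = hypermatchings k (Fin (k * n)) := rfl
  rw [hM] at hsub
  obtain ⟨x, hx, hFx⟩ := hn₀ n hn (Fin (k * n)) (Fintype.card_fin _) F hsub
    (fun m hm m' hm' => partially2Intersect_iff.1 (hint m hm m' hm'))
    (fun x _ => hmax _ ⟨filter_subset _ _, fun m hm m' hm' => partially2Intersect_iff.2
      (not_disjoint_iff.2 ⟨x, (mem_filter.1 hm).2, (mem_filter.1 hm').2⟩)⟩)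
  obtain ⟨i, j, hij, rfl⟩ := card_eq_two.1 hx
  refine ⟨i, j, hij, ?_⟩
  rw [hFx, canonicalFamily, hM]
  ext m
  simp only [mem_filter, pair_mem_pairs, SameEdge, ne_eq, hij, not_false_eq_true, true_and]
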